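/- Conventions. All collections are indexed by arities $n\ge 1$. A (topological) quasi-operad is a collection of spaces $O(n)$ with $\mathbb S_n$-actions and continuous equivariant compositions $\circ_i:O(m)\times O(n)\to O(m+n-1)$, $1\le i\le m$, not necessarily associative (no unit is required); an operad is an associative quasi-operad. We write $\cong$ for isomorphism; $P\sim Q$ for two quasi-operad structures on the same collection if they are joined by a continuous family $\circ_i(t)$, $t\in[0,1]$, of quasi-operad structures; and $P\simeq Q$ if there is a morphism of quasi-operads $P\to Q$ which is an $\mathbb S_n$-equivariant homotopy equivalence in each arity $n$. Spineless cacti $\mathcal Cact(n)$: rooted planar tree-like configurations of $n$ labelled parameterized circles (lobes) of arbitrary positive radii, up to isotopy, such that the global zero (root) is the zero of its lobe and at each intersection point the higher circles are attached at their zeros. Such a configuration is determined by its perimeter: the circle of length $R=\sum r_j$, based at the global zero, divided into arcs labelled by the lobes along which the outside circle runs. Let $\mathcal Cact^1(n)$ be the normalized spineless cacti (all radii one), with the topology of the CW complex whose closed cells are the products of simplices $\prod_{j}\Delta^{|j|}$ of arc lengths ($|j|+1$ being the number of arcs of the lobe $j$), indexed by the planar planted bipartite trees with $n$ labelled white vertices;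 faces are identified by contracting arcs. Then $\mathcal Cact(n)=\mathcal Cact^1(n)\times\mathbb R_{>0}^n$ as spaces (via normalization and the radii). Cacti (with spines) and normalized cacti are $\mathcal Cacti(n)=\mathcal Cact(n)\times(S^1)^n$ and $\mathcal Cacti^1(n)=\mathcal Cact^1(n)\times(S^1)^n$; the circle coordinates are the positions of a local zero on each lobe. The groups $\mathbb S_n$ permute labels. The composition $c\circ_i c'$ in $\mathcal Cact$ (in $\mathcal Cacti$) reparameterizes the outside circle of $c'$ to the length $r_i$ of the $i$-th lobe of $c$ and identifies it with this lobe, placing the global zero of $c'$ at the zero (the local zero) of the lobe. In $\mathcal Cact^1$, $\mathcal Cacti^1$ one instead reparameterizes the $i$-th lobe of $c$ to length $m$, the number of lobes of $c'$, before gluing. The scaling operad is $\mathcal R_{>0}(n)=\mathbb R_{>0}^n$ with $$(r_1,\dots,r_n)\circ_i(r'_1,\dots,r'_m)=\Bigl(r_1,\dots,r_{i-1},\tfrac{r_i}{R'}r'_1,\dots,\tfrac{r_i}{R'}r'_m,r_{i+1},\dots,r_n\Bigr),\qquad R'=\sum_k r'_k .$$ For normalized (spineless) cacti $c,c'$ and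 $\vec r'\in\mathcal R_{>0}(m)$, $m$ the arity of $c'$, the perturbed composition $c\circ_i^{\vec r'}c'$ is obtained by scaling the $j$-th lobe of $c'$ by $r'_j$ for all $j$, scaling the $i$-th lobe of $c$ by $R'$, gluing, and scaling all lobes of the result back to one. Theorem. $\mathcal R_{>0}$, $\mathcal Cact$ and $\mathcal Cacti$ are operads, $\mathcal Cact^1$ and $\mathcal Cacti^1$ are quasi-operads, and the perturbed compositions are continuous and equivariant. The semi-direct products $\mathcal R_{>0}\ltimes\mathcal Cact^1$ and $\mathcal R_{>0}\ltimes\mathcal Cacti^1$, with compositions $$(\vec r,c)\circ_i(\vec r',c')=(\vec r\circ_i\vec r',\;c\circ_i^{\vec r'}c'),$$ are operads, and $$\mathcal Cact\;\cong\;\mathcal R_{>0}\ltimes\mathcal Cact^1\;\sim\;\mathcal Cact^1\times\mathcal R_{>0}\;\simeq\;\mathcal Cact^1,\qquad \mathcal Cacti\;\cong\;\mathcal R_{>0}\ltimes\mathcal Cacti^1\;\sim\;\mathcal Cacti^1\times\mathcal R_{>0}\;\simeq\;\mathcal Cacti^1,$$ where $\cong$ is an isomorphism of operads, $\times$ is the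 direct product of quasi-operads, and in $\sim$ the two factors of the direct product are interchanged so that both structures live on the same collection. -/

import Mathlib

open Set Filter Topology

namespace CactiOperads

noncomputable section

/-- Positive real numbers, with the subspace topology. -/
abbrev PosReal : Type := {x : ℝ // 0 < x}

/-! ### Spineless cacti -/

/-- A spineless cactus with `n` labelled lobes, up to isotopy, described by its perimeter (outside
circle), i.e. as a chord diagram. The perimeter is a circle of length `perim`, parameterized by
`ℝ / perim • ℤ` in the positive sense with the global zero at `0`; `label x` is the lobe along
which the perimeter runs (towards increasing parameters) at the point `x`. So `label` is a periodic
function on the universal cover `ℝ` which is constant on finitely many half-open arcs per period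
(conditions `right` and `left`), and every lobe occurs. The lobe `j` is the circle obtained by
joining the arcs labelled `j` end to end; the cactus is obtained by collapsing the chords
between the ends of consecutive arcs of the same lobe. The configuration is planar and tree-like
iff no two lobes are interlaced along the perimeter (condition `noncrossing`). The zero of each lobe
is the first point of the lobe that the perimeter reaches from the global zero, as is required for
spineless cacti. -/
structure SpinelessCactus (n : ℕ) where
  perim : ℝ
  label : ℝ → Fin n
  perim_pos : 0 < perim
  periodic : ∀ x, label (x + perim) = label x
  right : ∀ x, ∀ᶠ y in 𝓝[≥] x, label y = label x
  left : ∀ x, ∃ j, ∀ᶠ y in 𝓝[<] x, label y = j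
  surj : ∀ j, ∃ x, label x = j
  noncrossing : ∀ a b c d, a < b → b < c → c < d → d < a + perim →
    label a = label c → label b = label d → label a = label b

/-- A continuous function on `ℝ` that is locally constant to the right of every point is constant. -/
lemma const_of_right {F : ℝ → ℝ} (hF : Continuous F)
    (h : ∀ x, ∀ᶠ y in 𝓝[≥] x, F y = F x) (x y : ℝ) : F x = F y := by
  wlog hxy : x ≤ y generalizing x y
  · exact (this y x (le_of_not_ge hxy)).symm
  refine (constant_of_has_deriv_right_zero (f := F) (a := x) (b := y) hF.continuousOn
    (fun z _ => ?_) y ⟨hxy, le_rfl⟩).symm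
  exact (hasDerivWithinAt_const z (Ici z) (F z)).congr_of_eventuallyEq (h z) rfl

lemma surjective_of_shift {f : ℝ → ℝ} (hf : Continuous f) {R T : ℝ} (hT : 0 < T)
    (h : ∀ x, f (x + R) = f x + T) : Function.Surjective f := by
  have hk : ∀ k : ℕ, f (k * R) = f 0 + k * T ∧ f (-(k * R)) = f 0 - k * T := by
    intro k
    induction k with
    | zero => simp
    | succ k ih =>
      constructor
      · have := h (k * R)
        push_cast
        rw [show ((k : ℝ) + 1) * R = k * R + R by ring, this, ih.1]; ring
      · have := h (-((k + 1 : ℝ) * R))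
        rw [show -((k + 1 : ℝ) * R) + R = -(k * R) by ring, ih.2] at this
        push_cast
        linarith
  intro y
  obtain ⟨k, hk'⟩ := exists_nat_gt (|y - f 0| / T)
  rw [div_lt_iff₀ hT] at hk'
  have h1 := abs_lt.mp hk'
  have hm : y ∈ uIcc (f (-(k * R))) (f (k * R)) := by
    rw [(hk k).1, (hk k).2]
    exact mem_uIcc.mpr (Or.inl ⟨by linarith, by linarith⟩)
  obtain ⟨x, -, hx⟩ := intermediate_value_uIcc hf.continuousOn hm
  exact ⟨x, hx⟩

namespace SpinelessCactus

variable {n : ℕ}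

/-- `c.arc j x` is the length of the part of lobe `j` that is traversed by the perimeter between the
global zero and the point `x` (counted negatively for `x < 0`). Modulo `c.radius j`, it is the
position on the circle of lobe `j`, counted from the zero of the lobe, of a perimeter point `x`. -/
def arc (c : SpinelessCactus n) (j : Fin n) (x : ℝ) : ℝ :=
  ∫ y in (0 : ℝ)..x, if c.label y = j then (1 : ℝ) else 0

/-- The radius of the lobe `j`: the sum of the lengths of its arcs. (Lengths are normalized so that
a circle of radius `r` has length `r`.) -/
def radius (c : SpinelessCactus n) (j : Fin n) : ℝ := c.arc j c.perim

lemma ext' {c d : SpinelessCactus n} (h : c.perim = d.perim) (h' : c.label = d.label) : c = d := by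
  cases c; cases d; simp only at h h'; subst h h'; rfl

lemma intervalIntegrable (c : SpinelessCactus n) (j : Fin n) (a b : ℝ) :
    IntervalIntegrable (fun y => if c.label y = j then (1 : ℝ) else 0) MeasureTheory.volume a b := by
  have hl : MeasureTheory.LocallyIntegrable (fun y => if c.label y = j then (1 : ℝ) else 0) := by
    intro x
    rw [← nhdsLT_sup_nhdsGE, MeasureTheory.IntegrableAtFilter.sup_iff]
    constructor
    · obtain ⟨i, hi⟩ := c.left x
      obtain ⟨u, hu, hi⟩ := mem_nhdsLT_iff_exists_Ioo_subset.mp hi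
      refine ⟨Ioo u x, Ioo_mem_nhdsLT hu, ?_⟩
      refine (MeasureTheory.integrableOn_const (C := if i = j then (1 : ℝ) else 0)
        (by simp)).congr_fun (fun y hy => ?_) measurableSet_Ioo
      have := hi hy
      simp only [mem_ofPred_eq] at this
      simp [this]
    · obtain ⟨u, hu, hi⟩ := mem_nhdsGE_iff_exists_Ico_subset.mp (c.right x)
      refine ⟨Ico x u, Ico_mem_nhdsGE hu, ?_⟩
      refine (MeasureTheory.integrableOn_const (C := if c.label x = j then (1 : ℝ) else 0)
        (by simp)).congr_fun (fun y hy => ?_) measurableSet_Ico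
      have := hi hy
      simp only [mem_ofPred_eq] at this
      simp [this]
  exact (hl.integrableOn_isCompact isCompact_uIcc).intervalIntegrable

lemma arc_zero (c : SpinelessCactus n) (j : Fin n) : c.arc j 0 = 0 := by simp [arc]

lemma arc_sub (c : SpinelessCactus n) (j : Fin n) (x y : ℝ) :
    c.arc j y - c.arc j x = ∫ z in x..y, if c.label z = j then (1 : ℝ) else 0 :=
  intervalIntegral.integral_interval_sub_left (c.intervalIntegrable j _ _)
    (c.intervalIntegrable j _ _)

lemma arc_continuous (c : SpinelessCactus n) (j : Fin n) : Continuous (c.arc j) :=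
  intervalIntegral.continuous_primitive (c.intervalIntegrable j) 0

lemma arc_mono (c : SpinelessCactus n) (j : Fin n) : Monotone (c.arc j) := by
  intro x y hxy
  rw [← sub_nonneg, arc_sub]
  refine intervalIntegral.integral_nonneg hxy (fun z _ => ?_)
  split_ifs <;> norm_num

lemma arc_right (c : SpinelessCactus n) (j : Fin n) (x : ℝ) :
    ∀ᶠ y in 𝓝[≥] x, c.arc j y = c.arc j x + (if c.label x = j then 1 else 0) * (y - x) := by
  obtain ⟨u, hu, hi⟩ := mem_nhdsGE_iff_exists_Ico_subset.mp (c.right x)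
  filter_upwards [Ico_mem_nhdsGE hu] with y hy
  have h : c.arc j y - c.arc j x = ∫ z in x..y, if c.label x = j then (1 : ℝ) else 0 := by
    rw [arc_sub]
    refine intervalIntegral.integral_congr (fun z hz => ?_)
    rw [uIcc_of_le hy.1] at hz
    have := hi ⟨hz.1, hz.2.trans_lt hy.2⟩
    simp only [mem_ofPred_eq] at this
    simp [this]
  rw [intervalIntegral.integral_const, smul_eq_mul] at h
  linarith [h, mul_comm (y - x) (if c.label x = j then (1 : ℝ) else 0)]

lemma arc_lt (c : SpinelessCactus n) {x y : ℝ} (hxy : x < y) :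
    c.arc (c.label x) x < c.arc (c.label x) y := by
  have h1 : ∀ᶠ z in 𝓝[>] x, c.arc (c.label x) z = c.arc (c.label x) x +
      (if c.label x = c.label x then 1 else 0) * (z - x) :=
    nhdsWithin_mono x Ioi_subset_Ici_self (c.arc_right _ x)
  obtain ⟨z, hz, hz'⟩ := (h1.and (Ioo_mem_nhdsGT hxy)).exists
  rw [if_pos rfl] at hz
  have := c.arc_mono (c.label x) hz'.2.le
  linarith [hz'.1]

lemma tendsto_shift (a x : ℝ) : Tendsto (fun y : ℝ => y + a) (𝓝[≥] x) (𝓝[≥] (x + a)) := by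
  refine tendsto_nhdsWithin_iff.mpr ⟨?_, ?_⟩
  · exact ((continuous_add_const a).tendsto x).mono_left nhdsWithin_le_nhds
  · filter_upwards [self_mem_nhdsWithin] with y hy
    simpa using hy

lemma arc_add_perim (c : SpinelessCactus n) (j : Fin n) (x : ℝ) :
    c.arc j (x + c.perim) = c.arc j x + c.radius j := by
  have h := const_of_right (F := fun x => c.arc j (x + c.perim) - c.arc j x)
    (((c.arc_continuous j).comp (continuous_add_const _)).sub (c.arc_continuous j))
    (fun x => by
      filter_upwards [c.arc_right j x,
        (tendsto_shift c.perim x).eventually (c.arc_right j (x + c.perim))] with y h1 h2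
      rw [h1, h2, c.periodic]; ring) x 0
  simp only [zero_add, arc_zero] at h
  simp only [radius]; linarith

lemma radius_pos (c : SpinelessCactus n) (j : Fin n) : 0 < c.radius j := by
  obtain ⟨x, rfl⟩ := c.surj j
  have := c.arc_lt (x := x) (y := x + c.perim) (by linarith [c.perim_pos])
  rw [arc_add_perim] at this
  linarith

lemma sum_arc (c : SpinelessCactus n) (x : ℝ) : ∑ j, c.arc j x = x := by
  have h := const_of_right (F := fun x => ∑ j, c.arc j x - x)
    ((continuous_finsetSum _ (fun j _ => c.arc_continuous j)).sub continuous_id)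
    (fun x => by
      filter_upwards [eventually_all.mpr (fun j => c.arc_right j x)] with y hy
      simp only [hy, Finset.sum_add_distrib, ← Finset.sum_mul]
      simp; ring) x 0
  simp only [arc_zero, Finset.sum_const_zero, sub_zero] at h
  linarith

lemma sum_radius (c : SpinelessCactus n) : ∑ j, c.radius j = c.perim := c.sum_arc c.perim

lemma exists_arc_eq (c : SpinelessCactus n) (j : Fin n) (v : ℝ) :
    ∃ x, c.label x = j ∧ c.arc j x = v := by
  obtain ⟨x₀, hx₀⟩ := surjective_of_shift (c.arc_continuous j) (c.radius_pos j)
    (c.arc_add_perim j) v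
  set S : Set ℝ := {x | c.arc j x = v}
  have hne : S.Nonempty := ⟨x₀, hx₀⟩
  have hbd : BddAbove S := by
    refine ⟨x₀ + c.perim, fun x hx => ?_⟩
    by_contra hlt
    have h1 := c.arc_mono j (le_of_not_ge hlt)
    rw [arc_add_perim, hx₀, show c.arc j x = v from hx] at h1
    linarith [c.radius_pos j]
  have hcl : IsClosed S := isClosed_eq (c.arc_continuous j) continuous_const
  have hmem : c.arc j (sSup S) = v := hcl.csSup_mem hne hbd
  refine ⟨sSup S, ?_, hmem⟩
  by_contra hlab
  have h1 : ∀ᶠ y in 𝓝[>] (sSup S), c.arc j y = c.arc j (sSup S) +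
      (if c.label (sSup S) = j then 1 else 0) * (y - sSup S) :=
    nhdsWithin_mono _ Ioi_subset_Ici_self (c.arc_right j _)
  obtain ⟨y, hy, hy'⟩ := (h1.and self_mem_nhdsWithin).exists
  rw [if_neg hlab, zero_mul, add_zero, hmem] at hy
  exact absurd (le_csSup hbd (show y ∈ S from hy)) (not_le.mpr hy')

/-! ### Rescaling the lobes -/

/-- The reparameterization of the perimeter that stretches the arcs of each lobe `j` homogeneously by
the factor `t j / c.radius j`. -/
def stretch (c : SpinelessCactus n) (t : Fin n → PosReal) (x : ℝ) : ℝ :=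
  ∑ j, (t j : ℝ) / c.radius j * c.arc j x


lemma stretch_continuous (c : SpinelessCactus n) (t : Fin n → PosReal) : Continuous (c.stretch t) :=
  continuous_finsetSum _ (fun j _ => continuous_const.mul (c.arc_continuous j))

lemma ratio_pos (c : SpinelessCactus n) (t : Fin n → PosReal) (j : Fin n) : 0 < (t j : ℝ) / c.radius j := div_pos (t j).2 (c.radius_pos j)

lemma stretch_strictMono (c : SpinelessCactus n) (t : Fin n → PosReal) : StrictMono (c.stretch t) := by
  intro x y hxy
  refine Finset.sum_lt_sum (fun j _ => ?_) ⟨c.label x, Finset.mem_univ _, ?_⟩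
  · exact mul_le_mul_of_nonneg_left (c.arc_mono j hxy.le) (c.ratio_pos t j).le
  · exact mul_lt_mul_of_pos_left (c.arc_lt hxy) (c.ratio_pos t _)

lemma stretch_add_perim (c : SpinelessCactus n) (t : Fin n → PosReal) (x : ℝ) : c.stretch t (x + c.perim) = c.stretch t x + ∑ j, (t j : ℝ) := by
  simp only [stretch, arc_add_perim, mul_add, Finset.sum_add_distrib]
  congr 1
  exact Finset.sum_congr rfl (fun j _ => div_mul_cancel₀ _ (c.radius_pos j).ne')

lemma sum_pos (c : SpinelessCactus n) (t : Fin n → PosReal) : 0 < ∑ j, (t j : ℝ) :=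
  Finset.sum_pos (fun j _ => (t j).2) ⟨c.label 0, Finset.mem_univ _⟩

lemma stretch_right (c : SpinelessCactus n) (t : Fin n → PosReal) (x : ℝ) :
    ∀ᶠ y in 𝓝[≥] x, c.stretch t y =
      c.stretch t x + (t (c.label x) : ℝ) / c.radius (c.label x) * (y - x) := by
  filter_upwards [eventually_all.mpr (fun j => c.arc_right j x)] with y hy
  simp only [stretch, hy, mul_add, Finset.sum_add_distrib]
  simp

/-- The stretching of the perimeter as an order isomorphism of `ℝ`. -/
def stretchIso (c : SpinelessCactus n) (t : Fin n → PosReal) : ℝ ≃o ℝ :=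
  (c.stretch_strictMono t).orderIsoOfSurjective _
    (surjective_of_shift (c.stretch_continuous t) (c.sum_pos t) (c.stretch_add_perim t))

lemma stretchIso_apply (c : SpinelessCactus n) (t : Fin n → PosReal) (x : ℝ) : c.stretchIso t x = c.stretch t x := rfl

lemma stretchIso_symm_add (c : SpinelessCactus n) (t : Fin n → PosReal) (y : ℝ) :
    (c.stretchIso t).symm (y + ∑ j, (t j : ℝ)) = (c.stretchIso t).symm y + c.perim := by
  rw [OrderIso.symm_apply_eq, stretchIso_apply, stretch_add_perim, ← stretchIso_apply,
    OrderIso.apply_symm_apply]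

lemma tendsto_orderIso_right (e : ℝ ≃o ℝ) (x : ℝ) : Tendsto e (𝓝[≥] x) (𝓝[≥] (e x)) :=
  tendsto_nhdsWithin_iff.mpr ⟨(e.continuous.tendsto x).mono_left nhdsWithin_le_nhds, by
    filter_upwards [self_mem_nhdsWithin] with y hy
    exact e.monotone hy⟩

lemma tendsto_orderIso_left (e : ℝ ≃o ℝ) (x : ℝ) : Tendsto e (𝓝[<] x) (𝓝[<] (e x)) :=
  tendsto_nhdsWithin_iff.mpr ⟨(e.continuous.tendsto x).mono_left nhdsWithin_le_nhds, by
    filter_upwards [self_mem_nhdsWithin] with y hy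
    exact e.strictMono hy⟩

/-- The cactus obtained from `c` by scaling the lobe `j` to radius `t j`, for every `j`. -/
def withRadii (c : SpinelessCactus n) (t : Fin n → PosReal) : SpinelessCactus n where
  perim := ∑ j, (t j : ℝ)
  label y := c.label ((c.stretchIso t).symm y)
  perim_pos := c.sum_pos t
  periodic y := by rw [stretchIso_symm_add, c.periodic]
  right y := (tendsto_orderIso_right (c.stretchIso t).symm y).eventually (c.right _)
  left y := by
    obtain ⟨j, hj⟩ := c.left ((c.stretchIso t).symm y)
    exact ⟨j, (tendsto_orderIso_left (c.stretchIso t).symm y).eventually hj⟩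
  surj j := by
    obtain ⟨x, hx⟩ := c.surj j
    exact ⟨c.stretchIso t x, by simpa using hx⟩
  noncrossing a b p d h1 h2 h3 h4 := by
    refine c.noncrossing _ _ _ _ ((c.stretchIso t).symm.strictMono h1)
      ((c.stretchIso t).symm.strictMono h2) ((c.stretchIso t).symm.strictMono h3) ?_
    rw [← stretchIso_symm_add]
    exact (c.stretchIso t).symm.strictMono h4

lemma arc_withRadii (c : SpinelessCactus n) (t : Fin n → PosReal) (j : Fin n) (x : ℝ) :
    (c.withRadii t).arc j (c.stretch t x) = (t j : ℝ) / c.radius j * c.arc j x := by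
  have h := const_of_right
    (F := fun x => (c.withRadii t).arc j (c.stretch t x) - (t j : ℝ) / c.radius j * c.arc j x)
    ((((c.withRadii t).arc_continuous j).comp (c.stretch_continuous t)).sub
      (continuous_const.mul (c.arc_continuous j)))
    (fun x => by
      have hl : (c.withRadii t).label (c.stretch t x) = c.label x :=
        congrArg c.label ((c.stretchIso t).symm_apply_apply x)
      filter_upwards [c.arc_right j x, c.stretch_right t x,
        (tendsto_orderIso_right (c.stretchIso t) x).eventually
          ((c.withRadii t).arc_right j (c.stretch t x))] with y h1 h2 h3
      rw [stretchIso_apply] at h3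
      rw [h3, h1, h2, hl]
      split_ifs with hj
      · rw [hj]; ring
      · ring) x 0
  have h0 : c.stretch t 0 = 0 := by simp [stretch, arc_zero]
  simp only [h0, arc_zero, mul_zero, sub_zero] at h
  linarith

lemma radius_withRadii (c : SpinelessCactus n) (t : Fin n → PosReal) (j : Fin n) : (c.withRadii t).radius j = t j := by
  have h0 : c.stretch t 0 = 0 := by simp [stretch, arc_zero]
  have h1 := c.stretch_add_perim t 0
  rw [zero_add, h0, zero_add] at h1
  have h := c.arc_withRadii t j c.perim
  rw [h1] at h
  exact h.trans (div_mul_cancel₀ _ (c.radius_pos j).ne')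


end SpinelessCactus

/-! ### Insertion of labels -/

/-- The relabelling for a composition `∘ᵢ` of an element of arity `m + 1` with one of arity `n + 1`:
the labels `a < i` of the first are kept, the `n + 1` labels of the second become
`i, …, i + n`, and the labels `a > i` of the first are shifted by `n`. -/
def insertFun {m n k : ℕ} (h : m + n = k) (i : Fin (m + 1)) :
    {a : Fin (m + 1) // a ≠ i} ⊕ Fin (n + 1) → Fin (k + 1)
  | Sum.inl a => if a.1 < i then ⟨a.1, by omega⟩ else ⟨a.1 + n, by omega⟩
  | Sum.inr b => ⟨i + b, by omega⟩

lemma insertFun_bijective {m n k : ℕ} (h : m + n = k) (i : Fin (m + 1)) :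
    Function.Bijective (insertFun (n := n) h i) := by
  rw [Fintype.bijective_iff_injective_and_card]
  constructor
  · rintro (⟨a, ha⟩ | b) (⟨a', ha'⟩ | b') hab
    · have h1 : a.1 ≠ i.1 := fun e => ha (Fin.ext e)
      have h2 : a'.1 ≠ i.1 := fun e => ha' (Fin.ext e)
      have : a = a' := by
        ext
        simp only [insertFun, Fin.lt_def] at hab
        split_ifs at hab <;> simp only [Fin.mk.injEq] at hab <;> omega
      subst this; rfl
    · have h1 : a.1 ≠ i.1 := fun e => ha (Fin.ext e)
      simp only [insertFun, Fin.lt_def] at hab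
      split_ifs at hab <;> simp only [Fin.mk.injEq] at hab <;> omega
    · have h1 : a'.1 ≠ i.1 := fun e => ha' (Fin.ext e)
      simp only [insertFun, Fin.lt_def] at hab
      split_ifs at hab <;> simp only [Fin.mk.injEq] at hab <;> omega
    · have : b = b' := by
        ext
        simp only [insertFun, Fin.mk.injEq] at hab
        omega
      rw [this]
  · simp [Fintype.card_subtype_compl]
    omega

/-- The relabelling for a composition `∘ᵢ`, as a bijection. -/
def insertEquiv {m n k : ℕ} (h : m + n = k) (i : Fin (m + 1)) :
    {a : Fin (m + 1) // a ≠ i} ⊕ Fin (n + 1) ≃ Fin (k + 1) :=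
  Equiv.ofBijective (insertFun h i) (insertFun_bijective h i)

/-- The permutation `σ ∘ᵢ τ` of `m + n + 1` letters: `σ` permutes the letters and the block that
replaces the letter `i`, and `τ` permutes the letters inside the block. -/
def blockPerm {m n k : ℕ} (h : m + n = k) (i : Fin (m + 1)) (σ : Equiv.Perm (Fin (m + 1)))
    (τ : Equiv.Perm (Fin (n + 1))) : Equiv.Perm (Fin (k + 1)) :=
  (insertEquiv h i).symm.trans
    ((Equiv.sumCongr (σ.subtypeEquiv (fun a => by simp)) τ).trans (insertEquiv h (σ i)))

namespace SpinelessCactus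

/-- The point of the outside circle of `d` that is glued to the point `x` of the lobe `i` of `c` (where
`c.label x = i`), if the outside circle of `d` is reparameterized to the length of lobe `i` and
the global zero of `d` is placed at the point of lobe `i` with coordinate `θ` (the length of the arc
from the zero of the lobe, divided by the radius). -/
def pos {m n : ℕ} (c : SpinelessCactus m) (i : Fin m) (θ : ℝ) (d : SpinelessCactus n) (x : ℝ) : ℝ :=
  d.perim * (c.arc i x / c.radius i - θ)

variable {m n k : ℕ}

lemma pos_continuous (c : SpinelessCactus m) (i : Fin m) (θ : ℝ) (d : SpinelessCactus n) :
    Continuous (c.pos i θ d) :=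
  continuous_const.mul (((c.arc_continuous i).div_const _).sub continuous_const)

lemma pos_mono (c : SpinelessCactus m) (i : Fin m) (θ : ℝ) (d : SpinelessCactus n) :
    Monotone (c.pos i θ d) := fun _ _ h =>
  mul_le_mul_of_nonneg_left
    (sub_le_sub_right (div_le_div_of_nonneg_right (c.arc_mono i h) (c.radius_pos i).le) _)
    d.perim_pos.le

lemma pos_lt (c : SpinelessCactus m) (i : Fin m) (θ : ℝ) (d : SpinelessCactus n) {x y : ℝ}
    (h : x < y) (hx : c.label x = i) : c.pos i θ d x < c.pos i θ d y := by
  subst hx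
  exact mul_lt_mul_of_pos_left
    (sub_lt_sub_right (div_lt_div_of_pos_right (c.arc_lt h) (c.radius_pos _)) _) d.perim_pos

lemma pos_add_perim (c : SpinelessCactus m) (i : Fin m) (θ : ℝ) (d : SpinelessCactus n) (x : ℝ) :
    c.pos i θ d (x + c.perim) = c.pos i θ d x + d.perim := by
  have := (c.radius_pos i).ne'
  simp only [pos, arc_add_perim]
  field_simp
  ring

lemma tendsto_pos (c : SpinelessCactus m) (i : Fin m) (θ : ℝ) (d : SpinelessCactus n) (x : ℝ) :
    Tendsto (c.pos i θ d) (𝓝[≥] x) (𝓝[≥] (c.pos i θ d x)) :=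
  tendsto_nhdsWithin_iff.mpr
    ⟨((c.pos_continuous i θ d).tendsto x).mono_left nhdsWithin_le_nhds, by
      filter_upwards [self_mem_nhdsWithin] with y hy
      exact c.pos_mono i θ d hy⟩

/-- The perimeter labels after gluing: outside of lobe `i` the perimeter runs along `c` as before, and
instead of running along lobe `i` it runs along the outside circle of `d`. -/
def glueLabel (h : m + n = k) (i : Fin (m + 1)) (c : SpinelessCactus (m + 1)) (θ : ℝ)
    (d : SpinelessCactus (n + 1)) (x : ℝ) : Fin (k + 1) :=
  if hx : c.label x = i then insertEquiv h i (Sum.inr (d.label (c.pos i θ d x)))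
  else insertEquiv h i (Sum.inl ⟨c.label x, hx⟩)

lemma glueLabel_pos (h : m + n = k) (i : Fin (m + 1)) (c : SpinelessCactus (m + 1)) (θ : ℝ)
    (d : SpinelessCactus (n + 1)) {x : ℝ} (hx : c.label x = i) :
    glueLabel h i c θ d x = insertEquiv h i (Sum.inr (d.label (c.pos i θ d x))) := dif_pos hx

lemma glueLabel_neg (h : m + n = k) (i : Fin (m + 1)) (c : SpinelessCactus (m + 1)) (θ : ℝ)
    (d : SpinelessCactus (n + 1)) {x : ℝ} {a : Fin (m + 1)} (ha : a ≠ i) (hx : c.label x = a) :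
    glueLabel h i c θ d x = insertEquiv h i (Sum.inl ⟨a, ha⟩) := by
  subst hx
  exact dif_neg ha

/-- Gluing of `d` into the lobe `i` of `c`: the outside circle of `d` is reparameterized to the length
of lobe `i` and identified with lobe `i`, the global zero of `d` being placed at the point of lobe `i`
with coordinate `θ`. -/
def glue (h : m + n = k) (i : Fin (m + 1)) (c : SpinelessCactus (m + 1)) (θ : ℝ)
    (d : SpinelessCactus (n + 1)) : SpinelessCactus (k + 1) where
  perim := c.perim
  label := glueLabel h i c θ d
  perim_pos := c.perim_pos
  periodic x := by
    simp only [glueLabel, c.periodic, pos_add_perim, d.periodic]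
  right x := by
    by_cases hx : c.label x = i
    · filter_upwards [c.right x, (c.tendsto_pos i θ d x).eventually (d.right _)] with y h1 h2
      rw [glueLabel_pos h i c θ d hx, glueLabel_pos h i c θ d (h1.trans hx), h2]
    · filter_upwards [c.right x] with y h1
      rw [glueLabel_neg h i c θ d hx rfl, glueLabel_neg h i c θ d hx h1]
  left x := by
    obtain ⟨j, hj⟩ := c.left x
    by_cases hji : j = i
    · obtain ⟨l, hl⟩ := d.left (c.pos i θ d x)
      refine ⟨insertEquiv h i (Sum.inr l), ?_⟩
      have ht : Tendsto (c.pos i θ d) (𝓝[<] x) (𝓝[<] (c.pos i θ d x)) := by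
        refine tendsto_nhdsWithin_iff.mpr
          ⟨((c.pos_continuous i θ d).tendsto x).mono_left nhdsWithin_le_nhds, ?_⟩
        filter_upwards [hj, self_mem_nhdsWithin] with y h1 h2
        exact c.pos_lt i θ d h2 (h1.trans hji)
      filter_upwards [hj, ht.eventually hl] with y h1 h2
      rw [glueLabel_pos h i c θ d (h1.trans hji), h2]
    · refine ⟨insertEquiv h i (Sum.inl ⟨j, hji⟩), ?_⟩
      filter_upwards [hj] with y h1
      rw [glueLabel_neg h i c θ d hji h1]
  surj l := by
    obtain ⟨z, rfl⟩ := (insertEquiv h i).surjective l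
    rcases z with ⟨a, ha⟩ | b
    · obtain ⟨x, hx⟩ := c.surj a
      exact ⟨x, glueLabel_neg h i c θ d ha hx⟩
    · obtain ⟨u, hu⟩ := d.surj b
      obtain ⟨x, hx, hx'⟩ := c.exists_arc_eq i (c.radius i * (u / d.perim + θ))
      refine ⟨x, ?_⟩
      have h1 := (c.radius_pos i).ne'
      have h2 := d.perim_pos.ne'
      have : c.pos i θ d x = u := by
        simp only [pos, hx']
        field_simp
        ring
      rw [glueLabel_pos h i c θ d hx, this, hu]
  noncrossing x y z w h1 h2 h3 h4 hxz hyw := by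
    by_cases hx : c.label x = i
    · by_cases hz : c.label z = i
      · by_cases hy : c.label y = i
        · by_cases hw : c.label w = i
          · rw [glueLabel_pos h i c θ d hx, glueLabel_pos h i c θ d hz] at hxz
            rw [glueLabel_pos h i c θ d hy, glueLabel_pos h i c θ d hw] at hyw
            rw [glueLabel_pos h i c θ d hx, glueLabel_pos h i c θ d hy]
            have hxz' := Sum.inr_injective ((insertEquiv h i).injective hxz)
            have hyw' := Sum.inr_injective ((insertEquiv h i).injective hyw)
            rw [d.noncrossing _ _ _ _ (c.pos_lt i θ d h1 hx) (c.pos_lt i θ d h2 hy)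
              (c.pos_lt i θ d h3 hz)
              (by rw [← pos_add_perim]; exact c.pos_lt i θ d h4 hw) hxz' hyw']
          · rw [glueLabel_pos h i c θ d hy, glueLabel_neg h i c θ d hw rfl] at hyw
            exact absurd ((insertEquiv h i).injective hyw) (by simp)
        · by_cases hw : c.label w = i
          · rw [glueLabel_pos h i c θ d hw, glueLabel_neg h i c θ d hy rfl] at hyw
            exact absurd ((insertEquiv h i).injective hyw) (by simp)
          · rw [glueLabel_neg h i c θ d hy rfl, glueLabel_neg h i c θ d hw rfl] at hyw
            have hyw' := Sum.inl_injective ((insertEquiv h i).injective hyw)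
            have := c.noncrossing x y z w h1 h2 h3 h4 (hx.trans hz.symm)
              (congrArg Subtype.val hyw')
            exact absurd (this.symm.trans hx) hy
      · rw [glueLabel_pos h i c θ d hx, glueLabel_neg h i c θ d hz rfl] at hxz
        exact absurd ((insertEquiv h i).injective hxz) (by simp)
    · by_cases hz : c.label z = i
      · rw [glueLabel_pos h i c θ d hz, glueLabel_neg h i c θ d hx rfl] at hxz
        exact absurd ((insertEquiv h i).injective hxz) (by simp)
      · rw [glueLabel_neg h i c θ d hx rfl, glueLabel_neg h i c θ d hz rfl] at hxz
        have hxz' : c.label x = c.label z :=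
          congrArg Subtype.val (Sum.inl_injective ((insertEquiv h i).injective hxz))
        by_cases hy : c.label y = i
        · by_cases hw : c.label w = i
          · have := c.noncrossing x y z w h1 h2 h3 h4 hxz' (hy.trans hw.symm)
            exact absurd (this.trans hy) hx
          · rw [glueLabel_pos h i c θ d hy, glueLabel_neg h i c θ d hw rfl] at hyw
            exact absurd ((insertEquiv h i).injective hyw) (by simp)
        · by_cases hw : c.label w = i
          · rw [glueLabel_pos h i c θ d hw, glueLabel_neg h i c θ d hy rfl] at hyw
            exact absurd ((insertEquiv h i).injective hyw) (by simp)
          · rw [glueLabel_neg h i c θ d hy rfl, glueLabel_neg h i c θ d hw rfl] at hyw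
            have hyw' : c.label y = c.label w :=
              congrArg Subtype.val (Sum.inl_injective ((insertEquiv h i).injective hyw))
            have := c.noncrossing x y z w h1 h2 h3 h4 hxz' hyw'
            rw [glueLabel_neg h i c θ d hy this, glueLabel_neg h i c θ d hy rfl]

lemma radius_glue_inl (h : m + n = k) (i : Fin (m + 1)) (c : SpinelessCactus (m + 1)) (θ : ℝ)
    (d : SpinelessCactus (n + 1)) (a : {a : Fin (m + 1) // a ≠ i}) :
    (glue h i c θ d).radius (insertEquiv h i (Sum.inl a)) = c.radius a := by
  unfold radius arc
  refine intervalIntegral.integral_congr (fun x _ => ?_)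
  have : (glue h i c θ d).label x = insertEquiv h i (Sum.inl a) ↔ c.label x = a.1 := by
    constructor
    · intro hx
      by_cases hi : c.label x = i
      · have := (glueLabel_pos h i c θ d hi).symm.trans hx
        exact absurd ((insertEquiv h i).injective this) (by simp)
      · have := (glueLabel_neg h i c θ d hi rfl).symm.trans hx
        exact congrArg Subtype.val (Sum.inl_injective ((insertEquiv h i).injective this))
    · exact fun hx => glueLabel_neg h i c θ d a.2 hx
  simp only [this]

lemma arc_glue_inr (h : m + n = k) (i : Fin (m + 1)) (c : SpinelessCactus (m + 1)) (θ : ℝ)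
    (d : SpinelessCactus (n + 1)) (b : Fin (n + 1)) (x : ℝ) :
    (glue h i c θ d).arc (insertEquiv h i (Sum.inr b)) x =
      c.radius i / d.perim * (d.arc b (c.pos i θ d x) - d.arc b (c.pos i θ d 0)) := by
  have hr := (c.radius_pos i).ne'
  have hp := d.perim_pos.ne'
  have key := const_of_right (F := fun x => (glue h i c θ d).arc (insertEquiv h i (Sum.inr b)) x -
      c.radius i / d.perim * (d.arc b (c.pos i θ d x) - d.arc b (c.pos i θ d 0)))
    (((glue h i c θ d).arc_continuous _).sub (continuous_const.mul
      (((d.arc_continuous b).comp (c.pos_continuous i θ d)).sub continuous_const)))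
    (fun x => by
      filter_upwards [c.arc_right i x, (c.tendsto_pos i θ d x).eventually (d.arc_right b _),
        (glue h i c θ d).arc_right (insertEquiv h i (Sum.inr b)) x] with y h1 h2 h3
      have h4 : c.pos i θ d y - c.pos i θ d x =
          d.perim / c.radius i * ((if c.label x = i then 1 else 0) * (y - x)) := by
        simp only [pos, h1]; field_simp; ring
      rw [h3, h2, h4]
      by_cases hi : c.label x = i
      · have e : (glue h i c θ d).label x = insertEquiv h i (Sum.inr b) ↔
            d.label (c.pos i θ d x) = b := by
          rw [show (glue h i c θ d).label x = _ from glueLabel_pos h i c θ d hi]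
          simp
        simp only [e, hi, if_true]
        field_simp
        ring
      · have e : ¬ (glue h i c θ d).label x = insertEquiv h i (Sum.inr b) := by
          rw [show (glue h i c θ d).label x = _ from glueLabel_neg h i c θ d hi rfl]
          simp
        simp only [e, hi, if_false]
        ring) x 0
  simp only [arc_zero, sub_self, mul_zero] at key
  linarith

lemma radius_glue_inr (h : m + n = k) (i : Fin (m + 1)) (c : SpinelessCactus (m + 1)) (θ : ℝ)
    (d : SpinelessCactus (n + 1)) (b : Fin (n + 1)) :
    (glue h i c θ d).radius (insertEquiv h i (Sum.inr b)) =
      c.radius i / d.perim * d.radius b := by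
  have h1 := c.pos_add_perim i θ d 0
  rw [zero_add] at h1
  have := arc_glue_inr h i c θ d b c.perim
  rw [h1, arc_add_perim] at this
  exact this.trans (by ring)


lemma perim_withRadii (c : SpinelessCactus n) (t : Fin n → PosReal) :
    (c.withRadii t).perim = ∑ j, (t j : ℝ) := rfl

/-- The permutation of the labels of the lobes. -/
def relabel (σ : Equiv.Perm (Fin n)) (c : SpinelessCactus n) : SpinelessCactus n where
  perim := c.perim
  label x := σ (c.label x)
  perim_pos := c.perim_pos
  periodic x := by rw [c.periodic]
  right x := by filter_upwards [c.right x] with y hy; rw [hy]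
  left x := by
    obtain ⟨j, hj⟩ := c.left x
    exact ⟨σ j, by filter_upwards [hj] with y hy; rw [hy]⟩
  surj j := by
    obtain ⟨x, hx⟩ := c.surj (σ.symm j)
    exact ⟨x, by rw [hx, Equiv.apply_symm_apply]⟩
  noncrossing a b p d h1 h2 h3 h4 h5 h6 := by
    rw [c.noncrossing a b p d h1 h2 h3 h4 (σ.injective h5) (σ.injective h6)]

lemma radius_relabel (σ : Equiv.Perm (Fin n)) (c : SpinelessCactus n) (j : Fin n) :
    (c.relabel σ).radius j = c.radius (σ⁻¹ j) := by
  unfold radius arc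
  refine intervalIntegral.integral_congr (fun x _ => ?_)
  have : (c.relabel σ).label x = j ↔ c.label x = σ⁻¹ j := by
    rw [Equiv.Perm.eq_inv_iff_eq]; rfl
  simp only [this]

/-- The radii of all lobes. -/
def radii (c : SpinelessCactus n) : Fin n → PosReal := fun j => ⟨c.radius j, c.radius_pos j⟩

end SpinelessCactus

/-- The set of normalized spineless cacti with `n` lobes: all lobes have radius one. -/
def NormSpinelessCactus (n : ℕ) : Type := {c : SpinelessCactus n // ∀ j, c.radius j = 1}

/-- Scale all lobes of a cactus to radius one. -/
def normalize {n : ℕ} (c : SpinelessCactus n) : NormSpinelessCactus n :=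
  ⟨c.withRadii (fun _ => ⟨1, one_pos⟩), fun j => c.radius_withRadii _ j⟩

/-- Topological types of normalized spineless cacti with `n` lobes. A planar planted bipartite
black-and-white tree with white leaves, black root and `n` labelled white vertices is encoded by
its contour word: going around the tree, starting at the root, one writes down, for every passage
from one edge of a white vertex `v` to the next one, the label of `v`. The letters with label `v`
are thus in bijection with the edges incident to `v`, i.e. with the arcs of the lobe `v`. The words
that arise are those in which each label occurs, consecutive letters differ and no two labels are
interlaced. -/
structure IsTopType {n k : ℕ} (w : Fin k → Fin n) : Prop where
  surj : Function.Surjective w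
  reduced : ∀ p q : Fin k, p.1 + 1 = q.1 → w p ≠ w q
  noncrossing : ∀ p q r s : Fin k, p < q → q < r → r < s → w p = w r → w q = w s → w p = w q

/-- The closed cell `Δ(τ)` of a topological type: the product over all lobes (white vertices) `j` of
the closed simplices of the tuples of lengths of the arcs of the lobe `j`, with sum one. -/
def Cell {n k : ℕ} (w : Fin k → Fin n) : Type :=
  {l : Fin k → ℝ // (∀ p, 0 ≤ l p) ∧ ∀ j, ∑ p with w p = j, l p = 1}

instance {n k : ℕ} (w : Fin k → Fin n) : TopologicalSpace (Cell w) := instTopologicalSpaceSubtype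

/-- The characteristic map of a closed cell, given by its graph: `c` is the normalized cactus whose
perimeter, starting at the global zero, runs along the arcs with labels `w 0, w 1, …` and lengths
`l 0, l 1, …`. Arcs of length zero are degenerate: on the faces of the cell, the arcs with length
zero have been contracted. -/
def Realizes {n k : ℕ} (w : Fin k → Fin n) (l : Cell w) (c : NormSpinelessCactus n) : Prop :=
  ∀ (p : Fin k) (y : ℝ), ∑ q with q < p, l.1 q ≤ y → y < ∑ q with q ≤ p, l.1 q →
    c.1.label y = w p

/-- The topology of the CW complex with the closed cells `Δ(τ)`: the final topology with respect to
the characteristic maps of all cells. -/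
instance (n : ℕ) : TopologicalSpace (NormSpinelessCactus n) :=
  ⨆ (k : ℕ) (w : {w : Fin k → Fin n // IsTopType w}),
    TopologicalSpace.coinduced
      (fun z : {z : Cell w.1 × NormSpinelessCactus n // Realizes w.1 z.1 z.2} => z.1.2)
      (TopologicalSpace.induced (fun z => z.1.1) inferInstance)

/-- The topology on spineless cacti is that of the product of the space of normalized spineless cacti
with `ℝ_{>0}ⁿ`, via normalization and the radii. -/
instance (n : ℕ) : TopologicalSpace (SpinelessCactus n) :=
  TopologicalSpace.induced (fun c => (normalize c, c.radii)) inferInstance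

/-! ### Quasi-operads and operads in topological spaces -/

/-- A collection of spaces with actions of the symmetric groups. `space n` is the space of arity `n + 1`. -/
structure SymSpaces where
  space : ℕ → Type
  top : ∀ n, TopologicalSpace (space n)
  act : ∀ n, Equiv.Perm (Fin (n + 1)) → space n → space n
  act_one : ∀ n x, act n 1 x = x
  act_mul : ∀ n σ τ x, act n (σ * τ) x = act n σ (act n τ x)

attribute [instance] SymSpaces.top

/-- Composition maps `∘ᵢ : X(m + 1) × X(n + 1) → X(m + n + 1)` on a collection (without any laws). The
index `i` is counted from `0`. -/
structure Compositions (X : SymSpaces) where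
  comp : ∀ {m n k : ℕ}, m + n = k → Fin (m + 1) → X.space m → X.space n → X.space k

/-- A topological quasi-operad: the actions and compositions are continuous, and the compositions are
equivariant (written for left actions). -/
structure IsQuasiOperad {X : SymSpaces} (P : Compositions X) : Prop where
  continuous_act : ∀ n σ, Continuous (X.act n σ)
  continuous_comp : ∀ {m n k : ℕ} (h : m + n = k) (i : Fin (m + 1)),
    Continuous fun z : X.space m × X.space n => P.comp h i z.1 z.2
  equivariant : ∀ {m n k : ℕ} (h : m + n = k) (i : Fin (m + 1)) (σ : Equiv.Perm (Fin (m + 1)))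
    (τ : Equiv.Perm (Fin (n + 1))) (x : X.space m) (y : X.space n),
    P.comp h (σ i) (X.act m σ x) (X.act n τ y) = X.act k (blockPerm h i σ τ) (P.comp h i x y)

/-- An operad is a quasi-operad that is associative: `(x ∘ᵢ y) ∘ⱼ z` is `x ∘ᵢ (y ∘ z)` if the
input `j` comes from an input of `y`, and `(x ∘ₐ z) ∘ y` if it comes from the input `a ≠ i` of `x`
(where `a < i` and `a > i` are the two remaining cases of associativity). -/
structure IsOperad {X : SymSpaces} (P : Compositions X) : Prop extends IsQuasiOperad P where
  assoc_seq : ∀ {k l m p q r : ℕ} (h₁ : k + l = p) (h₂ : p + m = r) (h₃ : l + m = q)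
    (h₄ : k + q = r) (i : Fin (k + 1)) (b : Fin (l + 1))
    (x : X.space k) (y : X.space l) (z : X.space m),
    P.comp h₂ (insertEquiv h₁ i (Sum.inr b)) (P.comp h₁ i x y) z =
      P.comp h₄ i x (P.comp h₃ b y z)
  assoc_par : ∀ {k l m p q r : ℕ} (h₁ : k + l = p) (h₂ : p + m = r) (h₃ : k + m = q)
    (h₄ : q + l = r) (i a : Fin (k + 1)) (hai : a ≠ i)
    (x : X.space k) (y : X.space l) (z : X.space m),
    P.comp h₂ (insertEquiv h₁ i (Sum.inl ⟨a, hai⟩)) (P.comp h₁ i x y) z =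
      P.comp h₄ (insertEquiv h₃ a (Sum.inl ⟨i, hai.symm⟩)) (P.comp h₃ a x z) y

/-- A morphism of quasi-operads preserves all structures. -/
structure IsMorphism {X Y : SymSpaces} (P : Compositions X) (Q : Compositions Y)
    (f : ∀ n, X.space n → Y.space n) : Prop where
  continuous : ∀ n, Continuous (f n)
  map_act : ∀ n σ x, f n (X.act n σ x) = Y.act n σ (f n x)
  map_comp : ∀ {m n k : ℕ} (h : m + n = k) (i : Fin (m + 1)) (x : X.space m) (y : X.space n),
    f k (P.comp h i x y) = Q.comp h i (f m x) (f n y)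

/-- Isomorphism `P ≅ Q` of (quasi-)operads. -/
def Isomorphic {X Y : SymSpaces} (P : Compositions X) (Q : Compositions Y) : Prop :=
  ∃ (f : ∀ n, X.space n → Y.space n) (g : ∀ n, Y.space n → X.space n),
    IsMorphism P Q f ∧ IsMorphism Q P g ∧
      (∀ n x, g n (f n x) = x) ∧ (∀ n y, f n (g n y) = y)

/-- Homotopy through equivariant maps. -/
def EquivariantlyHomotopic {X Y : SymSpaces} (n : ℕ) (f g : X.space n → Y.space n) : Prop :=
  ∃ H : unitInterval × X.space n → Y.space n, Continuous H ∧
    (∀ x, H (0, x) = f x) ∧ (∀ x, H (1, x) = g x) ∧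
    ∀ t σ x, H (t, X.act n σ x) = Y.act n σ (H (t, x))

/-- Equivariant homotopy equivalences in arity `n + 1`. -/
def IsEquivariantHomotopyEquiv {X Y : SymSpaces} (n : ℕ) (f : X.space n → Y.space n) : Prop :=
  Continuous f ∧ (∀ σ x, f (X.act n σ x) = Y.act n σ (f x)) ∧
  ∃ g : Y.space n → X.space n, Continuous g ∧ (∀ σ y, g (Y.act n σ y) = X.act n σ (g y)) ∧
    EquivariantlyHomotopic (X := X) (Y := X) n (g ∘ f) id ∧
    EquivariantlyHomotopic (X := Y) (Y := Y) n (f ∘ g) id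

/-- `P ≃ Q`: there is an equivalence from `P` to `Q`, i.e. a morphism of quasi-operads that is an
equivariant homotopy equivalence in each arity. -/
def Equivalent {X Y : SymSpaces} (P : Compositions X) (Q : Compositions Y) : Prop :=
  ∃ f : ∀ n, X.space n → Y.space n, IsMorphism P Q f ∧
    ∀ n, IsEquivariantHomotopyEquiv (X := X) (Y := Y) n (f n)

/-- `P ∼ Q`: the two quasi-operad structures on the collection `X` are homotopy equivalent through
quasi-operads. -/
def HomotopyEquivalent {X : SymSpaces} (P Q : Compositions X) : Prop :=
  ∃ H : unitInterval → Compositions X, H 0 = P ∧ H 1 = Q ∧ (∀ t, IsQuasiOperad (H t)) ∧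
    ∀ {m n k : ℕ} (h : m + n = k) (i : Fin (m + 1)),
      Continuous fun z : unitInterval × X.space m × X.space n => (H z.1).comp h i z.2.1 z.2.2

/-- The product of two collections, with the diagonal actions. -/
def prodSpaces (X Y : SymSpaces) : SymSpaces where
  space n := X.space n × Y.space n
  top n := inferInstance
  act n σ z := (X.act n σ z.1, Y.act n σ z.2)
  act_one n z := by simp [X.act_one, Y.act_one]
  act_mul n σ τ z := by simp [X.act_mul, Y.act_mul]

/-- The direct product of two quasi-operads. -/
def directProduct {X Y : SymSpaces} (P : Compositions X) (Q : Compositions Y) :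
    Compositions (prodSpaces X Y) where
  comp h i z w := (P.comp h i z.1 w.1, Q.comp h i z.2 w.2)

/-- Perturbed compositions `y ∘ᵢ^x y'` of `Y`, depending on an element `x` of the same arity as `y'`. -/
structure Perturbed (X Y : SymSpaces) where
  comp : ∀ {m n k : ℕ}, m + n = k → Fin (m + 1) →
    Y.space m → X.space n → Y.space n → Y.space k

/-- The requirements on perturbed compositions: they are continuous, and equivariant with the second
symmetric group acting diagonally on the last two arguments. -/
structure IsPerturbed {X Y : SymSpaces} (B : Perturbed X Y) : Prop where
  continuous_comp : ∀ {m n k : ℕ} (h : m + n = k) (i : Fin (m + 1)),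
    Continuous fun z : Y.space m × X.space n × Y.space n => B.comp h i z.1 z.2.1 z.2.2
  equivariant : ∀ {m n k : ℕ} (h : m + n = k) (i : Fin (m + 1)) (σ : Equiv.Perm (Fin (m + 1)))
    (τ : Equiv.Perm (Fin (n + 1))) (y : Y.space m) (x : X.space n) (y' : Y.space n),
    B.comp h (σ i) (Y.act m σ y) (X.act n τ x) (Y.act n τ y') =
      Y.act k (blockPerm h i σ τ) (B.comp h i y x y')

/-- The (right) semi-direct product `P ⋉ Y` with respect to perturbed compositions of `Y`:
`(x, y) ∘ᵢ (x', y') = (x ∘ᵢ x', y ∘ᵢ^{x'} y')`. -/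
def rightSemidirectProduct {X Y : SymSpaces} (P : Compositions X) (B : Perturbed X Y) :
    Compositions (prodSpaces X Y) where
  comp h i z w := (P.comp h i z.1 w.1, B.comp h i z.2 w.1 w.2)

/-- The permutation action on `n`-fold products. -/
def permute {n : ℕ} {S : Type} (σ : Equiv.Perm (Fin n)) (f : Fin n → S) : Fin n → S :=
  fun j => f (σ⁻¹ j)

/-- The spaces `ℝ_{>0}^{n + 1}` of the scaling operad. -/
def scalingSpaces : SymSpaces where
  space n := Fin (n + 1) → PosReal
  top n := inferInstance
  act n := permute
  act_one _ _ := rfl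
  act_mul _ σ τ x := by funext j; simp [permute, mul_inv_rev]

/-- The spaces of spineless cacti, with the permutation of the labels. -/
def cactSpaces : SymSpaces where
  space n := SpinelessCactus (n + 1)
  top _ := inferInstance
  act _ := SpinelessCactus.relabel
  act_one _ _ := rfl
  act_mul _ _ _ _ := rfl

/-- The spaces of normalized spineless cacti, with the permutation of the labels. -/
def cactNormSpaces : SymSpaces where
  space n := NormSpinelessCactus (n + 1)
  top _ := inferInstance
  act _ σ c := ⟨c.1.relabel σ, fun j => by rw [SpinelessCactus.radius_relabel, c.2]⟩
  act_one _ _ := rfl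
  act_mul _ _ _ _ := rfl

/-- The spaces of cacti with spines, `X(n) × (S¹)ⁿ` for `X` the (normalized) spineless cacti. The `j`-th
circle coordinate is the length of the arc from the first point of the lobe `j` reached by the
perimeter (the intersection point with the lower lobe, or the root), counter-clockwise to the local
zero of the lobe `j`, divided by the radius of the lobe. -/
def spinedSpaces (X : SymSpaces) : SymSpaces where
  space n := X.space n × (Fin (n + 1) → UnitAddCircle)
  top n := inferInstance
  act n σ z := (X.act n σ z.1, permute σ z.2)
  act_one n z := by rw [X.act_one]; rfl
  act_mul n σ τ z := by
    rw [X.act_mul]; congr 1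

/-- The sum of positive real numbers. -/
def total {n : ℕ} (r : Fin (n + 1) → PosReal) : PosReal :=
  ⟨∑ j, (r j : ℝ), Finset.sum_pos (fun j _ => (r j).2) ⟨0, Finset.mem_univ _⟩⟩

/-- The scaling operad:
`(r₁, …, rₙ) ∘ᵢ (r'₁, …, r'ₘ) = (r₁, …, rᵢ₋₁, rᵢ r'₁ / R, …, rᵢ r'ₘ / R, rᵢ₊₁, …, rₙ)`
with `R = ∑ r'ₖ`. -/
def scaling : Compositions scalingSpaces where
  comp h i r r' := fun l => Sum.elim (fun a => r a.1)
    (fun b => ⟨(r i : ℝ) / (total r' : ℝ) * r' b,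
      mul_pos (div_pos (r i).2 (total r').2) (r' b).2⟩) ((insertEquiv h i).symm l)

/-- The operad of spineless cacti: the outside circle of the second cactus is reparameterized to
the length of the `i`-th lobe of the first one and identified with that lobe, the global zero
being placed at the zero of the lobe. -/
def cact : Compositions cactSpaces where
  comp h i c d := c.glue h i 0 d

/-- The lobe `i` of `c` is rescaled to radius `t`, all other lobes are kept. -/
def SpinelessCactus.scaleLobe {n : ℕ} (c : SpinelessCactus n) (i : Fin n) (t : PosReal) :
    SpinelessCactus n :=
  c.withRadii (Function.update c.radii i t)

lemma radius_scaleLobe_self {n : ℕ} (c : SpinelessCactus n) (i : Fin n) (t : PosReal) :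
    (c.scaleLobe i t).radius i = t := by
  simp [SpinelessCactus.scaleLobe, SpinelessCactus.radius_withRadii]

lemma radius_scaleLobe_of_ne {n : ℕ} (c : SpinelessCactus n) {i j : Fin n} (t : PosReal)
    (hj : j ≠ i) : (c.scaleLobe i t).radius j = c.radius j := by
  simp [SpinelessCactus.scaleLobe, SpinelessCactus.radius_withRadii, hj, SpinelessCactus.radii]

/-- If `d` is normalized and has `n + 1` lobes, and the `i`-th lobe of the normalized cactus `c` is
first reparameterized to length `n + 1`, then gluing `d` into it gives a normalized cactus. -/
lemma radius_glue_norm {m n k : ℕ} (h : m + n = k) (i : Fin (m + 1))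
    (c : NormSpinelessCactus (m + 1)) (θ : ℝ) (d : NormSpinelessCactus (n + 1))
    (j : Fin (k + 1)) :
    ((c.1.scaleLobe i (total fun _ : Fin (n + 1) => ⟨1, one_pos⟩)).glue h i θ d.1).radius j = 1 := by
  obtain ⟨z, rfl⟩ := (insertEquiv h i).surjective j
  rcases z with a | b
  · rw [SpinelessCactus.radius_glue_inl, radius_scaleLobe_of_ne _ _ a.2, c.2]
  · rw [SpinelessCactus.radius_glue_inr, radius_scaleLobe_self, ← SpinelessCactus.sum_radius,
      d.2 b, mul_one]
    have hs : ∑ j, d.1.radius j = ∑ _j : Fin (n + 1), (1 : ℝ) :=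
      Finset.sum_congr rfl (fun j _ => d.2 j)
    rw [hs]
    exact div_self (total fun _ : Fin (n + 1) => ⟨1, one_pos⟩).2.ne'

/-- The quasi-operad of normalized spineless cacti: the `i`-th lobe of the first cactus is
reparameterized to length `n + 1`, the number of lobes of the second cactus, and then identified
with the outside circle of the second cactus. -/
def cactNorm : Compositions cactNormSpaces where
  comp {_ n _} h i c d :=
    ⟨(c.1.scaleLobe i (total fun _ : Fin (n + 1) => ⟨1, one_pos⟩)).glue h i 0 d.1,
      radius_glue_norm h i c 0 d⟩

/-- The perturbed compositions `c ∘ᵢ^r d` of normalized spineless cacti: scale the lobes of `d`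
according to `r`, scale the `i`-th lobe of `c` to `∑ r`, glue, and scale all lobes of the result
back to one. -/
def cactNormPerturbed : Perturbed scalingSpaces cactNormSpaces where
  comp h i c r d := normalize ((c.1.scaleLobe i (total r)).glue h i 0 (d.1.withRadii r))

/-- The representative in `[0, 1)` of a point of the circle `ℝ / ℤ`. -/
def lift (z : UnitAddCircle) : ℝ := (AddCircle.equivIco (1 : ℝ) 0 z : ℝ)

/-- The local zeros after gluing `(d, ξ)` into the `i`-th lobe of `(c, ζ)`. The coordinates on the
lobes of `c` are kept. The perimeter of the glued cactus meets the outside circle of `d` for the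
first time at the point `-(d.perim * ζ i)`; this point is the new origin of the coordinates of the
lobes of `d`. -/
def glueSpines {m n k : ℕ} (h : m + n = k) (i : Fin (m + 1)) (ζ : Fin (m + 1) → UnitAddCircle)
    (d : SpinelessCactus (n + 1)) (ξ : Fin (n + 1) → UnitAddCircle) :
    Fin (k + 1) → UnitAddCircle := fun l =>
  Sum.elim (fun a => ζ a.1)
    (fun b => ξ b - ((d.arc b (-(d.perim * lift (ζ i))) / d.radius b : ℝ) : UnitAddCircle))
    ((insertEquiv h i).symm l)

/-- The operad of cacti (with spines): as for spineless cacti, but now the local zero of the `i`-th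
lobe of the first cactus is identified with the global zero of the second cactus. -/
def cacti : Compositions (spinedSpaces cactSpaces) where
  comp h i c d := (c.1.glue h i (lift (c.2 i)) d.1, glueSpines h i c.2 d.1 d.2)

/-- The quasi-operad of normalized cacti (with spines). -/
def cactiNorm : Compositions (spinedSpaces cactNormSpaces) where
  comp {_ n _} h i c d :=
    (⟨(c.1.1.scaleLobe i (total fun _ : Fin (n + 1) => ⟨1, one_pos⟩)).glue h i (lift (c.2 i)) d.1.1,
      radius_glue_norm h i c.1 (lift (c.2 i)) d.1⟩,
      glueSpines h i c.2 d.1.1 d.2)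

/-- The perturbed compositions of normalized cacti (with spines). Scaling lobes homogeneously does
not change the coordinates (in `ℝ / ℤ`) of the local zeros. -/
def cactiNormPerturbed : Perturbed scalingSpaces (spinedSpaces cactNormSpaces) where
  comp h i c r d :=
    (normalize ((c.1.1.scaleLobe i (total r)).glue h i (lift (c.2 i)) (d.1.1.withRadii r)),
      glueSpines h i c.2 (d.1.1.withRadii r) d.2)

end

end CactiOperads

open CactiOperads

namespace CactiOperads

noncomputable section

/-! ### Combinatorics of the insertion of labels -/

/-! Everything is computed through the arc functions `arc j`. They are nondecreasing, add up to the
identity, and have right slope 1 where the perimeter runs along lobe `j` and 0 elsewhere; hence they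
determine the labels (`label_eq_of_arc`), and relabelling, rescaling of lobes and gluing all have
explicit formulas in terms of them.

Associativity of gluing is checked label by label along the perimeter. The only computation is that
the two bracketings reach the same point of the innermost outside circle. With spines this holds up
to whole turns, which do not affect a gluing (`glue_add_int`); the change of origin in `glueSpines`
is exactly the correction term in `glue_assoc_seq`.

Continuity rests on `topology_norm_eq`: the CW topology is that of pointwise convergence of the arc
functions. There are finitely many cells, each is compact, and the arc functions depend continuously
on the arc lengths, so the finer of the two topologies cannot be strictly finer. As all arc
functions are 1-Lipschitz, they may also be evaluated at points that vary, and the explicit formulas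
give continuity of every operation.

A cactus is the same as its radii together with its normalization. The radii of a glued cactus are
given by the scaling operad (`radii_glue`). Its normalization does not see the sizes of the lobes of
the first cactus, since stretching these commutes with gluing (`withRadii_glue`), but it does see
the radii of the second, which decide how its arcs spread over the lobe. This asymmetry is the
perturbed composition (`normalize_glue_normalize`). So the decomposition carries the cactus operad
to the semi-direct product, whose associativity follows by transport (`IsOperad.of_iso`).

Finally the perturbation vector is moved along a straight segment to the vector of ones. There the
perturbed composition is the normalized one, and the semi-direct product has become a direct
product; its scaling factor is equivariantly contractible to the vector of ones. -/

lemma coe_insertEquiv_inr {m n k : ℕ} (h : m + n = k) (i : Fin (m + 1)) (b : Fin (n + 1)) :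
    (insertEquiv h i (Sum.inr b) : ℕ) = i + b := rfl

lemma coe_insertEquiv_inl {m n k : ℕ} (h : m + n = k) (i : Fin (m + 1))
    (a : {a : Fin (m + 1) // a ≠ i}) :
    (insertEquiv h i (Sum.inl a) : ℕ) = if (a.1 : ℕ) < i then (a.1 : ℕ) else a.1 + n := by
  change (insertFun h i (Sum.inl a) : ℕ) = _
  simp only [insertFun, Fin.lt_def]
  split_ifs <;> rfl

/-- This lemma and the four that follow match the relabellings of the two sides of the associativity
laws, one for each origin of a label. All are comparisons of natural numbers: a block of inserted
labels only shifts the labels after it. -/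
lemma insertEquiv_inr_inr {k l m p q r : ℕ} (h₁ : k + l = p) (h₂ : p + m = r) (h₃ : l + m = q)
    (h₄ : k + q = r) (i : Fin (k + 1)) (b : Fin (l + 1)) (e : Fin (m + 1)) :
    insertEquiv h₂ (insertEquiv h₁ i (Sum.inr b)) (Sum.inr e) =
      insertEquiv h₄ i (Sum.inr (insertEquiv h₃ b (Sum.inr e))) := by
  ext
  simp only [coe_insertEquiv_inr]
  omega

lemma insertEquiv_seq_inl {k l m p q r : ℕ} (h₁ : k + l = p) (h₂ : p + m = r) (_h₃ : l + m = q)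
    (h₄ : k + q = r) (i : Fin (k + 1)) (b : Fin (l + 1)) (a : {a : Fin (k + 1) // a ≠ i})
    (ha : insertEquiv h₁ i (Sum.inl a) ≠ insertEquiv h₁ i (Sum.inr b)) :
    insertEquiv h₂ (insertEquiv h₁ i (Sum.inr b)) (Sum.inl ⟨insertEquiv h₁ i (Sum.inl a), ha⟩) =
      insertEquiv h₄ i (Sum.inl a) := by
  obtain ⟨a, ha'⟩ := a
  have h1 : a.1 ≠ i.1 := fun e => ha' (Fin.ext e)
  ext
  simp only [coe_insertEquiv_inr, coe_insertEquiv_inl]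
  split_ifs <;> omega

lemma insertEquiv_seq_inr {k l m p q r : ℕ} (h₁ : k + l = p) (h₂ : p + m = r) (h₃ : l + m = q)
    (h₄ : k + q = r) (i : Fin (k + 1)) (b : Fin (l + 1)) (b' : {b' : Fin (l + 1) // b' ≠ b})
    (hb : insertEquiv h₁ i (Sum.inr b'.1) ≠ insertEquiv h₁ i (Sum.inr b)) :
    insertEquiv h₂ (insertEquiv h₁ i (Sum.inr b)) (Sum.inl ⟨insertEquiv h₁ i (Sum.inr b'.1), hb⟩) =
      insertEquiv h₄ i (Sum.inr (insertEquiv h₃ b (Sum.inl b'))) := by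
  obtain ⟨b', hb'⟩ := b'
  have h1 : b'.1 ≠ b.1 := fun e => hb' (Fin.ext e)
  ext
  simp only [coe_insertEquiv_inr, coe_insertEquiv_inl]
  simp only [Nat.add_lt_add_iff_left]
  split_ifs <;> omega

lemma insertEquiv_par_inr {k l m p q r : ℕ} (h₁ : k + l = p) (h₂ : p + m = r) (h₃ : k + m = q)
    (h₄ : q + l = r) (i a : Fin (k + 1)) (hai : a ≠ i) (e : Fin (m + 1))
    (he : insertEquiv h₃ a (Sum.inr e) ≠ insertEquiv h₃ a (Sum.inl ⟨i, hai.symm⟩)) :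
    insertEquiv h₂ (insertEquiv h₁ i (Sum.inl ⟨a, hai⟩)) (Sum.inr e) =
      insertEquiv h₄ (insertEquiv h₃ a (Sum.inl ⟨i, hai.symm⟩))
        (Sum.inl ⟨insertEquiv h₃ a (Sum.inr e), he⟩) := by
  have h1 : a.1 ≠ i.1 := fun e => hai (Fin.ext e)
  ext
  simp only [coe_insertEquiv_inr, coe_insertEquiv_inl]
  split_ifs <;> omega

lemma insertEquiv_par_inl {k l m p q r : ℕ} (h₁ : k + l = p) (h₂ : p + m = r) (h₃ : k + m = q)
    (h₄ : q + l = r) (i a a' : Fin (k + 1)) (hai : a ≠ i) (hi : a' ≠ i) (ha : a' ≠ a)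
    (h₅ : insertEquiv h₁ i (Sum.inl ⟨a', hi⟩) ≠ insertEquiv h₁ i (Sum.inl ⟨a, hai⟩))
    (h₆ : insertEquiv h₃ a (Sum.inl ⟨a', ha⟩) ≠ insertEquiv h₃ a (Sum.inl ⟨i, hai.symm⟩)) :
    insertEquiv h₂ (insertEquiv h₁ i (Sum.inl ⟨a, hai⟩))
        (Sum.inl ⟨insertEquiv h₁ i (Sum.inl ⟨a', hi⟩), h₅⟩) =
      insertEquiv h₄ (insertEquiv h₃ a (Sum.inl ⟨i, hai.symm⟩))
        (Sum.inl ⟨insertEquiv h₃ a (Sum.inl ⟨a', ha⟩), h₆⟩) := by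
  have h1 : a.1 ≠ i.1 := fun e => hai (Fin.ext e)
  have h2 : a'.1 ≠ i.1 := fun e => hi (Fin.ext e)
  have h3 : a'.1 ≠ a.1 := fun e => ha (Fin.ext e)
  ext
  simp only [coe_insertEquiv_inl]
  split_ifs <;> omega

lemma insertEquiv_inr_ne_inl {m n k : ℕ} (h : m + n = k) (i : Fin (m + 1)) (b : Fin (n + 1))
    (a : {a : Fin (m + 1) // a ≠ i}) :
    insertEquiv h i (Sum.inr b) ≠ insertEquiv h i (Sum.inl a) :=
  fun e => Sum.inr_ne_inl ((insertEquiv h i).injective e)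

lemma insertEquiv_inr_ne {m n k : ℕ} (h : m + n = k) (i : Fin (m + 1)) {b b' : Fin (n + 1)}
    (hb : b' ≠ b) : insertEquiv h i (Sum.inr b') ≠ insertEquiv h i (Sum.inr b) :=
  fun e => hb (Sum.inr_injective ((insertEquiv h i).injective e))

lemma insertEquiv_inl_ne {m n k : ℕ} (h : m + n = k) (i : Fin (m + 1))
    {a a' : {a : Fin (m + 1) // a ≠ i}} (ha : a' ≠ a) :
    insertEquiv h i (Sum.inl a') ≠ insertEquiv h i (Sum.inl a) :=
  fun e => ha (Sum.inl_injective ((insertEquiv h i).injective e))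

lemma funext_insert {m n k : ℕ} (h : m + n = k) (i : Fin (m + 1)) {S : Type*}
    {f g : Fin (k + 1) → S}
    (hl : ∀ a, f (insertEquiv h i (Sum.inl a)) = g (insertEquiv h i (Sum.inl a)))
    (hr : ∀ b, f (insertEquiv h i (Sum.inr b)) = g (insertEquiv h i (Sum.inr b))) : f = g := by
  funext l
  obtain ⟨z, rfl⟩ := (insertEquiv h i).surjective l
  rcases z with a | b
  exacts [hl a, hr b]

lemma sum_insert {m n k : ℕ} (h : m + n = k) (i : Fin (m + 1)) (f : Fin (k + 1) → ℝ) :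
    ∑ l, f l = ∑ a, f (insertEquiv h i (Sum.inl a)) + ∑ b, f (insertEquiv h i (Sum.inr b)) := by
  rw [← (insertEquiv h i).sum_comp, Fintype.sum_sum_type]

lemma blockPerm_inl {m n k : ℕ} (h : m + n = k) (i : Fin (m + 1)) (σ : Equiv.Perm (Fin (m + 1)))
    (τ : Equiv.Perm (Fin (n + 1))) (a : {a : Fin (m + 1) // a ≠ i}) :
    blockPerm h i σ τ (insertEquiv h i (Sum.inl a)) =
      insertEquiv h (σ i) (Sum.inl ⟨σ a, fun e => a.2 (σ.injective e)⟩) := by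
  simp [blockPerm, Equiv.subtypeEquiv]

lemma blockPerm_inr {m n k : ℕ} (h : m + n = k) (i : Fin (m + 1)) (σ : Equiv.Perm (Fin (m + 1)))
    (τ : Equiv.Perm (Fin (n + 1))) (b : Fin (n + 1)) :
    blockPerm h i σ τ (insertEquiv h i (Sum.inr b)) = insertEquiv h (σ i) (Sum.inr (τ b)) := by
  simp [blockPerm]

/-- A family over the labels of a composition is `permute`d by a block permutation as soon as
its two parts are. -/
lemma eq_permute_blockPerm {m n k : ℕ} (h : m + n = k) (i : Fin (m + 1))
    (σ : Equiv.Perm (Fin (m + 1))) (τ : Equiv.Perm (Fin (n + 1))) {S : Type}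
    {f g : Fin (k + 1) → S}
    (hl : ∀ a : {a : Fin (m + 1) // a ≠ i},
      f (insertEquiv h (σ i) (Sum.inl ⟨σ a, fun e => a.2 (σ.injective e)⟩)) =
        g (insertEquiv h i (Sum.inl a)))
    (hr : ∀ b, f (insertEquiv h (σ i) (Sum.inr (τ b))) = g (insertEquiv h i (Sum.inr b))) :
    f = permute (blockPerm h i σ τ) g := by
  have : permute (blockPerm h i σ τ)⁻¹ f = g := by
    refine funext_insert h i (fun a => ?_) (fun b => ?_)
    · rw [← hl]; simp only [permute, inv_inv, blockPerm_inl]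
    · rw [← hr]; simp only [permute, inv_inv, blockPerm_inr]
  rw [← this]
  funext l
  simp [permute]

/-! ### Arcs determine cacti -/

namespace SpinelessCactus

variable {m n k : ℕ}

/-- The right slope of `arc j` at `x` is 1 exactly when the label there is `j`, so different labels
at `x` would separate the arc functions just to the right of `x`. -/
lemma label_eq_of_arc {c d : SpinelessCactus n} (h : ∀ j x, c.arc j x = d.arc j x) :
    c.label = d.label := by
  funext x
  by_contra hne
  have h1 := (c.arc_right (c.label x) x).filter_mono (nhdsWithin_mono x Ioi_subset_Ici_self)
  have h2 := (d.arc_right (c.label x) x).filter_mono (nhdsWithin_mono x Ioi_subset_Ici_self)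
  obtain ⟨y, ⟨hy1, hy2⟩, hy⟩ := ((h1.and h2).and self_mem_nhdsWithin).exists
  rw [if_pos rfl] at hy1
  rw [if_neg (Ne.symm hne)] at hy2
  rw [h, hy2, h] at hy1
  have : x < y := hy
  linarith

lemma ext_arc {c d : SpinelessCactus n} (hr : ∀ j, c.radius j = d.radius j)
    (h : ∀ j x, c.arc j x = d.arc j x) : c = d := by
  refine ext' ?_ (label_eq_of_arc h)
  rw [← sum_radius, ← sum_radius]
  exact Finset.sum_congr rfl fun j _ => hr j

/-- Since the stretch is onto, arc functions may be compared at stretched points. This criterion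
spares all later computations the inverse of the stretch. -/
lemma eq_withRadii {c d : SpinelessCactus n} {t : Fin n → PosReal}
    (hr : ∀ j, d.radius j = t j)
    (h : ∀ j x, d.arc j (c.stretch t x) = (t j : ℝ) / c.radius j * c.arc j x) :
    d = c.withRadii t := by
  refine ext_arc (fun j => by rw [hr, radius_withRadii]) (fun j y => ?_)
  obtain ⟨x, rfl⟩ := (c.stretchIso t).surjective y
  rw [stretchIso_apply, h, arc_withRadii]

/-! ### Repeated rescaling of the lobes -/

lemma coe_radii (c : SpinelessCactus n) (j : Fin n) : (c.radii j : ℝ) = c.radius j := rfl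

lemma radii_withRadii (c : SpinelessCactus n) (t : Fin n → PosReal) : (c.withRadii t).radii = t :=
  funext fun j => Subtype.ext (c.radius_withRadii t j)

lemma stretch_radii (c : SpinelessCactus n) (x : ℝ) : c.stretch c.radii x = x := by
  conv_rhs => rw [← c.sum_arc x]
  refine Finset.sum_congr rfl fun j _ => ?_
  rw [coe_radii, div_self (c.radius_pos j).ne', one_mul]

lemma withRadii_radii (c : SpinelessCactus n) : c.withRadii c.radii = c := by
  refine (eq_withRadii (fun _ => rfl) fun j x => ?_).symm
  rw [stretch_radii, coe_radii, div_self (c.radius_pos j).ne', one_mul]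

lemma withRadii_eq_self {c : SpinelessCactus n} {t : Fin n → PosReal}
    (h : ∀ j, c.radius j = t j) : c.withRadii t = c := by
  have : t = c.radii := funext fun j => Subtype.ext (h j).symm
  rw [this, withRadii_radii]

lemma stretch_stretch (c : SpinelessCactus n) (s t : Fin n → PosReal) (x : ℝ) :
    (c.withRadii s).stretch t (c.stretch s x) = c.stretch t x := by
  refine Finset.sum_congr rfl fun j _ => ?_
  have h1 := (c.radius_pos j).ne'
  have h2 := (s j).2.ne'
  rw [arc_withRadii, radius_withRadii]
  field_simp

/-- The intermediate radii `s` cancel: stretching to `s` and then to `t` is stretching to `t`. Hence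
normalization forgets nothing but the radii. -/
lemma withRadii_withRadii (c : SpinelessCactus n) (s t : Fin n → PosReal) :
    (c.withRadii s).withRadii t = c.withRadii t := by
  refine eq_withRadii (fun j => by rw [radius_withRadii]) fun j x => ?_
  have h1 := (c.radius_pos j).ne'
  have h2 := (s j).2.ne'
  rw [← c.stretch_stretch s t, arc_withRadii, arc_withRadii, radius_withRadii]
  field_simp

lemma arc_add_nat_perim (c : SpinelessCactus n) (j : Fin n) (x : ℝ) (N : ℕ) :
    c.arc j (x + N * c.perim) = c.arc j x + N * c.radius j := by
  induction N with
  | zero => simp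
  | succ N ih =>
    push_cast
    rw [show x + ((N : ℝ) + 1) * c.perim = x + N * c.perim + c.perim by ring, arc_add_perim, ih]
    ring

lemma arc_add_int_perim (c : SpinelessCactus n) (j : Fin n) (x : ℝ) (N : ℤ) :
    c.arc j (x + N * c.perim) = c.arc j x + N * c.radius j := by
  obtain ⟨N, rfl | rfl⟩ := N.eq_nat_or_neg
  · exact_mod_cast c.arc_add_nat_perim j x N
  · have := c.arc_add_nat_perim j (x + ((-N : ℤ) : ℝ) * c.perim) N
    push_cast at *
    rw [show x + -(N : ℝ) * c.perim + N * c.perim = x by ring] at this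
    linarith

lemma label_add_int_perim (c : SpinelessCactus n) (x : ℝ) (N : ℤ) :
    c.label (x + N * c.perim) = c.label x := by
  have := (show Function.Periodic c.label c.perim from c.periodic).int_mul N x
  simpa using this

/-! ### Arcs of glued and relabelled cacti -/

lemma arc_glue_inl (h : m + n = k) (i : Fin (m + 1)) (c : SpinelessCactus (m + 1)) (θ : ℝ)
    (d : SpinelessCactus (n + 1)) (a : {a : Fin (m + 1) // a ≠ i}) (x : ℝ) :
    (glue h i c θ d).arc (insertEquiv h i (Sum.inl a)) x = c.arc a x := by
  unfold arc
  refine intervalIntegral.integral_congr (fun x _ => ?_)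
  have : (glue h i c θ d).label x = insertEquiv h i (Sum.inl a) ↔ c.label x = a.1 := by
    constructor
    · intro hx
      by_cases hi : c.label x = i
      · have := (glueLabel_pos h i c θ d hi).symm.trans hx
        exact absurd ((insertEquiv h i).injective this) (by simp)
      · have := (glueLabel_neg h i c θ d hi rfl).symm.trans hx
        exact congrArg Subtype.val (Sum.inl_injective ((insertEquiv h i).injective this))
    · exact fun hx => glueLabel_neg h i c θ d a.2 hx
  simp only [this]

lemma arc_relabel (σ : Equiv.Perm (Fin n)) (c : SpinelessCactus n) (j : Fin n) (x : ℝ) :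
    (c.relabel σ).arc j x = c.arc (σ⁻¹ j) x := by
  unfold arc
  refine intervalIntegral.integral_congr (fun x _ => ?_)
  have : (c.relabel σ).label x = j ↔ c.label x = σ⁻¹ j := by
    rw [Equiv.Perm.eq_inv_iff_eq]; rfl
  simp only [this]

lemma pos_zero (c : SpinelessCactus m) (i : Fin m) (θ : ℝ) (d : SpinelessCactus n) :
    c.pos i θ d 0 = -(d.perim * θ) := by
  simp [pos, arc_zero]

/-- Gluing commutes with scaling the lobes of the first cactus. -/
lemma withRadii_glue (h : m + n = k) (i : Fin (m + 1)) (c : SpinelessCactus (m + 1)) (θ : ℝ)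
    (d : SpinelessCactus (n + 1)) (t : Fin (m + 1) → PosReal) :
    glue h i (c.withRadii t) θ d = (glue h i c θ d).withRadii (glue h i (c.withRadii t) θ d).radii := by
  -- The glued point depends only on the ratio of `arc i` to the radius of lobe `i`, which
  -- stretching preserves.
  have hp : ∀ x, (c.withRadii t).pos i θ d (c.stretch t x) = c.pos i θ d x := fun x => by
    have h1 := (c.radius_pos i).ne'
    have h2 := (t i).2.ne'
    simp only [pos, arc_withRadii, radius_withRadii]
    field_simp
  have key : ∀ l x, (glue h i (c.withRadii t) θ d).arc l (c.stretch t x) =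
      (glue h i (c.withRadii t) θ d).radius l / (glue h i c θ d).radius l *
        (glue h i c θ d).arc l x := by
    intro l x
    obtain ⟨z, rfl⟩ := (insertEquiv h i).surjective l
    rcases z with a | b
    · rw [arc_glue_inl, arc_glue_inl, radius_glue_inl, radius_glue_inl, arc_withRadii,
        radius_withRadii]
    · have h1 := (c.radius_pos i).ne'
      have h2 := (t i).2.ne'
      have h3 := (d.radius_pos b).ne'
      have h4 := d.perim_pos.ne'
      rw [arc_glue_inr, arc_glue_inr, radius_glue_inr, radius_glue_inr, hp, pos_zero, pos_zero,
        radius_withRadii]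
      field_simp
  refine eq_withRadii (fun _ => rfl) fun l x => ?_
  -- Summing `key` over all lobes shows that the stretch of the glued cactus is the stretch of `c`,
  -- because the arc functions of a cactus add up to the parameter.
  have hs : (glue h i c θ d).stretch (glue h i (c.withRadii t) θ d).radii x = c.stretch t x := by
    rw [← (glue h i (c.withRadii t) θ d).sum_arc (c.stretch t x)]
    exact Finset.sum_congr rfl fun l _ => (key l x).symm
  rw [hs, key, coe_radii]

lemma pos_add_int (c : SpinelessCactus m) (i : Fin m) (θ : ℝ) (N : ℤ) (d : SpinelessCactus n)
    (x : ℝ) : c.pos i (θ + N) d x = c.pos i θ d x + (-N : ℤ) * d.perim := by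
  simp only [pos]; push_cast; ring

/-- A whole turn of `θ` moves the points on the outside circle of `d` by whole perimeters, which its
labels do not notice. So gluing is well defined for an angle in `ℝ / ℤ`. -/
lemma glue_add_int (h : m + n = k) (i : Fin (m + 1)) (c : SpinelessCactus (m + 1)) (θ : ℝ) (N : ℤ)
    (d : SpinelessCactus (n + 1)) : glue h i c (θ + N) d = glue h i c θ d := by
  refine ext' rfl (funext fun x => ?_)
  simp only [glue, glueLabel, pos_add_int, label_add_int_perim]

lemma glue_relabel (h : m + n = k) (i : Fin (m + 1)) (c : SpinelessCactus (m + 1)) (θ : ℝ)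
    (d : SpinelessCactus (n + 1)) (σ : Equiv.Perm (Fin (m + 1))) (τ : Equiv.Perm (Fin (n + 1))) :
    glue h (σ i) (c.relabel σ) θ (d.relabel τ) = (glue h i c θ d).relabel (blockPerm h i σ τ) := by
  have hp : ∀ x, (c.relabel σ).pos (σ i) θ (d.relabel τ) x = c.pos i θ d x := fun x => by
    simp only [pos, arc_relabel, radius_relabel, Equiv.Perm.inv_def, Equiv.symm_apply_apply]; rfl
  refine ext' rfl (funext fun x => ?_)
  change glueLabel h (σ i) (c.relabel σ) θ (d.relabel τ) x =
    blockPerm h i σ τ (glueLabel h i c θ d x)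
  by_cases hx : c.label x = i
  · rw [glueLabel_pos h i c θ d hx, blockPerm_inr,
      glueLabel_pos h (σ i) _ θ _ (show σ (c.label x) = σ i by rw [hx]), hp]
    rfl
  · rw [glueLabel_neg h i c θ d hx rfl, blockPerm_inl]
    exact glueLabel_neg h (σ i) _ θ _ _ rfl

lemma withRadii_relabel (c : SpinelessCactus n) (t : Fin n → PosReal) (σ : Equiv.Perm (Fin n)) :
    (c.relabel σ).withRadii (permute σ t) = (c.withRadii t).relabel σ := by
  have hs : ∀ x, (c.relabel σ).stretch (permute σ t) x = c.stretch t x := fun x => by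
    simp only [stretch, permute, radius_relabel, arc_relabel]
    exact Equiv.sum_comp σ⁻¹ fun j => (t j : ℝ) / c.radius j * c.arc j x
  refine (eq_withRadii (fun j => ?_) fun j x => ?_).symm
  · rw [radius_relabel, radius_withRadii]; rfl
  · rw [hs, arc_relabel, arc_withRadii, radius_relabel, arc_relabel]; rfl

lemma radii_relabel (c : SpinelessCactus n) (σ : Equiv.Perm (Fin n)) :
    (c.relabel σ).radii = permute σ c.radii :=
  funext fun j => Subtype.ext (c.radius_relabel σ j)

/-! ### Associativity of gluing -/

/-- Sequential associativity of gluing: the angles have to be congruent modulo one. -/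
lemma glue_assoc_seq {k l m p q r : ℕ} (h₁ : k + l = p) (h₂ : p + m = r) (h₃ : l + m = q)
    (h₄ : k + q = r) (i : Fin (k + 1)) (b : Fin (l + 1)) (c : SpinelessCactus (k + 1))
    (d : SpinelessCactus (l + 1)) (e : SpinelessCactus (m + 1)) (θ θ' θ'' : ℝ) (N : ℤ)
    (hθ : θ' = θ'' - d.arc b (-(d.perim * θ)) / d.radius b + N) :
    glue h₂ (insertEquiv h₁ i (Sum.inr b)) (glue h₁ i c θ d) θ' e =
      glue h₄ i c θ (glue h₃ b d θ'' e) := by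
  subst hθ
  rw [glue_add_int]
  refine ext' rfl (funext fun x => ?_)
  change glueLabel _ _ _ _ _ x = glueLabel _ _ _ _ _ x
  -- The point lies outside lobe `i`, or on `i` but off lobe `b` of `d`, or on `b`; only in the last
  -- case do the angles enter.
  by_cases hx : c.label x = i
  · have h1 : (glue h₁ i c θ d).label x = insertEquiv h₁ i (Sum.inr (d.label (c.pos i θ d x))) :=
      glueLabel_pos h₁ i c θ d hx
    rw [glueLabel_pos h₄ i c _ _ hx, show c.pos i θ (glue h₃ b d θ'' e) x = c.pos i θ d x from rfl]
    by_cases hy : d.label (c.pos i θ d x) = b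
    · rw [glueLabel_pos h₂ _ _ _ _ (h1.trans (by rw [hy])), insertEquiv_inr_inr h₁ h₂ h₃ h₄,
        show (glue h₃ b d θ'' e).label _ = _ from glueLabel_pos h₃ b d θ'' e hy]
      -- It remains to compare two points of the outside circle of `e`. The correction by `d.arc b
      -- (-(d.perim * θ))` in the angle cancels the base value that `arc_glue_inr` subtracts at the
      -- global zero.
      congr 5
      have hr1 := (c.radius_pos i).ne'
      have hr2 := (d.radius_pos b).ne'
      have hr3 := d.perim_pos.ne'
      rw [pos, arc_glue_inr, radius_glue_inr, pos_zero, pos.eq_def d]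
      field_simp
      ring
    · rw [glueLabel_neg h₂ _ _ _ _ (insertEquiv_inr_ne h₁ i hy) h1,
        insertEquiv_seq_inr h₁ h₂ h₃ h₄ i b ⟨_, hy⟩,
        show (glue h₃ b d θ'' e).label _ = _ from glueLabel_neg h₃ b d θ'' e hy rfl]
  · rw [glueLabel_neg h₄ i c _ _ hx rfl,
      glueLabel_neg h₂ _ _ _ _ (insertEquiv_inr_ne_inl h₁ i b ⟨_, hx⟩).symm
        (glueLabel_neg h₁ i c θ d hx rfl), insertEquiv_seq_inl h₁ h₂ h₃ h₄]

/-- Gluing into one lobe leaves the coordinates on the other lobes alone; this is why gluings into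
different lobes commute without any condition on the angles. -/
lemma pos_glue_inl (h : m + n = k) (i : Fin (m + 1)) (c : SpinelessCactus (m + 1)) (θ θ' : ℝ)
    (d : SpinelessCactus (n + 1)) (a : {a : Fin (m + 1) // a ≠ i}) {l : ℕ} (e : SpinelessCactus l)
    (x : ℝ) :
    (glue h i c θ d).pos (insertEquiv h i (Sum.inl a)) θ' e x = c.pos a θ' e x := by
  rw [pos, arc_glue_inl, radius_glue_inl]; rfl

lemma glue_assoc_par {k l m p q r : ℕ} (h₁ : k + l = p) (h₂ : p + m = r) (h₃ : k + m = q)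
    (h₄ : q + l = r) (i a : Fin (k + 1)) (hai : a ≠ i) (c : SpinelessCactus (k + 1))
    (d : SpinelessCactus (l + 1)) (e : SpinelessCactus (m + 1)) (θ θ' : ℝ) :
    glue h₂ (insertEquiv h₁ i (Sum.inl ⟨a, hai⟩)) (glue h₁ i c θ d) θ' e =
      glue h₄ (insertEquiv h₃ a (Sum.inl ⟨i, hai.symm⟩)) (glue h₃ a c θ' e) θ d := by
  refine ext' rfl (funext fun x => ?_)
  change glueLabel _ _ _ _ _ x = glueLabel _ _ _ _ _ x
  by_cases hi : c.label x = i
  · have ha : c.label x ≠ a := fun e => hai (e.symm.trans hi)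
    have h1 := glueLabel_pos h₁ i c θ d hi
    have h2 := glueLabel_neg h₃ a c θ' e hai.symm hi
    rw [glueLabel_pos h₄ _ _ _ _ h2, glueLabel_neg h₂ _ _ _ _ (insertEquiv_inr_ne_inl h₁ i _ _) h1,
      pos_glue_inl, ← insertEquiv_par_inr h₃ h₄ h₁ h₂ a i hai.symm]
  · by_cases ha : c.label x = a
    · have h1 := glueLabel_neg h₁ i c θ d hai ha
      have h2 := glueLabel_pos h₃ a c θ' e ha
      rw [glueLabel_pos h₂ _ _ _ _ h1,
        glueLabel_neg h₄ _ _ _ _ (insertEquiv_inr_ne_inl h₃ a _ _) h2, pos_glue_inl,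
        ← insertEquiv_par_inr h₁ h₂ h₃ h₄ i a hai]
    · have h1 := glueLabel_neg h₁ i c θ d hi rfl
      have h2 := glueLabel_neg h₃ a c θ' e ha rfl
      rw [glueLabel_neg h₂ _ _ _ _
          (insertEquiv_inl_ne h₁ i fun e => ha (congrArg Subtype.val e)) h1,
        glueLabel_neg h₄ _ _ _ _
          (insertEquiv_inl_ne h₃ a fun e => hi (congrArg Subtype.val e)) h2]
      exact insertEquiv_par_inl h₁ h₂ h₃ h₄ i a _ hai hi ha _ _

end SpinelessCactus


/-! ### The CW topology is the topology of pointwise convergence of the arc functions -/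

namespace SpinelessCactus

variable {n : ℕ}

lemma arc_sub_of_const (c : SpinelessCactus n) {a b : ℝ} (hab : a ≤ b) {i : Fin n}
    (h : ∀ y, a ≤ y → y < b → c.label y = i) (j : Fin n) :
    c.arc j b - c.arc j a = if i = j then b - a else 0 := by
  rw [arc_sub, intervalIntegral.integral_of_le hab, MeasureTheory.integral_Ioc_eq_integral_Ioo,
    MeasureTheory.setIntegral_congr_fun (g := fun _ => if i = j then (1 : ℝ) else 0)
      measurableSet_Ioo (fun y hy => by simp only [h y hy.1.le hy.2])]
  split_ifs <;> simp [hab]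

lemma arc_sub_le (c : SpinelessCactus n) (j : Fin n) {x y : ℝ} (hxy : x ≤ y) :
    c.arc j y - c.arc j x ≤ y - x := by
  have h : ∑ j, (c.arc j y - c.arc j x) = y - x := by
    rw [Finset.sum_sub_distrib, sum_arc, sum_arc]
  rw [← h]
  exact Finset.single_le_sum (f := fun j => c.arc j y - c.arc j x)
    (fun j _ => sub_nonneg.mpr (c.arc_mono j hxy)) (Finset.mem_univ j)

/-- The Lipschitz constant is the same for all cacti. This makes it possible to evaluate a varying
arc function at a varying point in `continuous_arc_comp`. -/
lemma abs_arc_sub_le (c : SpinelessCactus n) (j : Fin n) (x y : ℝ) :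
    |c.arc j y - c.arc j x| ≤ |y - x| := by
  rcases le_total x y with h | h
  · rw [abs_of_nonneg (sub_nonneg.mpr (c.arc_mono j h)), abs_of_nonneg (sub_nonneg.mpr h)]
    exact c.arc_sub_le j h
  · rw [abs_sub_comm, abs_sub_comm y, abs_of_nonneg (sub_nonneg.mpr (c.arc_mono j h)),
      abs_of_nonneg (sub_nonneg.mpr h)]
    exact c.arc_sub_le j h

end SpinelessCactus

lemma perim_norm {n : ℕ} (c : NormSpinelessCactus n) : c.1.perim = n := by
  rw [← SpinelessCactus.sum_radius, Finset.sum_congr rfl fun j _ => c.2 j]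
  simp

/-- The sum of the first `p` lengths: the point of the perimeter where the `p`-th arc starts. -/
def breakpoint {k : ℕ} (l : Fin k → ℝ) (p : ℕ) : ℝ := ∑ q : Fin k with q.1 < p, l q

section Cells

variable {n k : ℕ}

lemma breakpoint_zero (l : Fin k → ℝ) : breakpoint l 0 = 0 := by simp [breakpoint]

lemma breakpoint_last (l : Fin k → ℝ) : breakpoint l k = ∑ q, l q := by simp [breakpoint]

lemma breakpoint_mono {l : Fin k → ℝ} (hl : ∀ p, 0 ≤ l p) : Monotone (breakpoint l) := by
  intro p q hpq
  refine Finset.sum_le_sum_of_subset_of_nonneg (fun r hr => ?_) fun r _ _ => hl r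
  simp only [Finset.mem_filter, Finset.mem_univ, true_and] at hr ⊢
  omega

lemma breakpoint_continuous (p : ℕ) : Continuous fun l : Fin k → ℝ => breakpoint l p :=
  continuous_finsetSum _ fun q _ => continuous_apply q

lemma realizes_iff {w : Fin k → Fin n} {l : Cell w} {c : NormSpinelessCactus n} :
    Realizes w l c ↔ ∀ (p : Fin k) (y : ℝ), breakpoint l.1 p ≤ y → y < breakpoint l.1 (p + 1) →
      c.1.label y = w p := by
  have h : ∀ p : Fin k, ∑ q with q ≤ p, l.1 q = breakpoint l.1 (p + 1) := fun p => by
    refine Finset.sum_congr (Finset.filter_congr fun q _ => ?_) fun _ _ => rfl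
    rw [Fin.le_def, Nat.lt_succ_iff]
  simp only [Realizes, h]
  rfl

lemma sum_cell {w : Fin k → Fin n} (l : Cell w) : ∑ p, l.1 p = n := by
  rw [← Finset.sum_fiberwise Finset.univ w, Finset.sum_congr rfl fun j _ => l.2.2 j]
  simp

/-- The arc functions of the cactus with arcs `w` of lengths `l`, on one period. -/
def cellArc (w : Fin k → Fin n) (l : Fin k → ℝ) (j : Fin n) (x : ℝ) : ℝ :=
  ∑ p : Fin k, if w p = j then min x (breakpoint l (p + 1)) - min x (breakpoint l p) else 0

/-- The truncations by `min` make `cellArc` continuous in the lengths also where arcs shrink to zero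
or a breakpoint passes `x`. -/
lemma cellArc_continuous (w : Fin k → Fin n) (j : Fin n) (x : ℝ) :
    Continuous fun l : Cell w => cellArc w l.1 j x := by
  refine continuous_finsetSum _ fun p _ => ?_
  split_ifs
  · exact (continuous_const.min ((breakpoint_continuous _).comp continuous_subtype_val)).sub
      (continuous_const.min ((breakpoint_continuous _).comp continuous_subtype_val))
  · exact continuous_const

/-- The increments of `arc j` over the pieces cut off at `x` telescope, and on each piece the label
is constant. -/
lemma arc_eq_sum_breakpoint (c : SpinelessCactus n) (w : ℕ → Fin n) (S : ℕ → ℝ) (hS : ∀ p < k,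
    S p ≤ S (p + 1)) (h0 : S 0 = 0)
    (h : ∀ p < k, ∀ y, S p ≤ y → y < S (p + 1) → c.label y = w p)
    (j : Fin n) {x : ℝ} (hx0 : 0 ≤ x) (hx : x ≤ S k) :
    c.arc j x = ∑ p : Fin k, if w p = j then min x (S (p + 1)) - min x (S p) else 0 := by
  have h1 : ∑ p : Fin k, (c.arc j (min x (S (p + 1))) - c.arc j (min x (S p))) = c.arc j x := by
    rw [Fin.sum_univ_eq_sum_range (fun p => c.arc j (min x (S (p + 1))) - c.arc j (min x (S p))),
      Finset.sum_range_sub (fun p => c.arc j (min x (S p))), h0, min_eq_left hx, min_eq_right hx0,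
      c.arc_zero, sub_zero]
  rw [← h1]
  refine Finset.sum_congr rfl fun p _ => ?_
  have hp := hS p p.2
  refine c.arc_sub_of_const (min_le_min_left x hp) (fun y hy1 hy2 => h p p.2 y ?_ ?_) j
  -- A point `y` of the truncated piece satisfies `y < x`, so the lower bound can only come from `S
  -- p`.
  · rcases min_le_iff.mp hy1 with hy | hy
    · exact absurd (hy2.trans_le (min_le_left _ _)) (not_lt.mpr hy)
    · exact hy
  · exact hy2.trans_le (min_le_right _ _)

lemma arc_eq_cellArc {w : Fin k → Fin n} {l : Cell w} {c : NormSpinelessCactus n}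
    (h : Realizes w l c) (j : Fin n) {x : ℝ} (hx0 : 0 ≤ x) (hx : x ≤ n) :
    c.1.arc j x = cellArc w l.1 j x := by
  rw [realizes_iff] at h
  -- The word is extended beyond its length by the arbitrary letter `j`; only positions below `k`
  -- are used.
  have := arc_eq_sum_breakpoint (k := k) c.1 (fun p => if hp : p < k then w ⟨p, hp⟩ else j)
    (breakpoint l.1) (fun p _ => breakpoint_mono l.2.1 p.le_succ) (breakpoint_zero _)
    (fun p hp y h1 h2 => by rw [dif_pos hp]; exact h ⟨p, hp⟩ y h1 h2) j hx0
    (by rwa [breakpoint_last, sum_cell])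
  rw [this]
  exact Finset.sum_congr rfl fun p _ => by simp

/-- If the label at a point `y` of the `p`-th arc were not `w p`, the arc function of that label
would increase strictly to the right of `y`, whereas the corresponding `cellArc` is constant along
the `p`-th arc. -/
lemma realizes_of_arc {w : Fin k → Fin n} {l : Cell w} {c : NormSpinelessCactus n}
    (h : ∀ (j : Fin n) (x : ℝ), 0 ≤ x → x ≤ n → c.1.arc j x = cellArc w l.1 j x) : Realizes w l c := by
  rw [realizes_iff]
  intro p y h1 h2
  by_contra hne
  have hm := breakpoint_mono l.2.1
  obtain ⟨z, hz1, hz2⟩ := exists_between h2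
  have h0 : 0 ≤ y := by
    have := hm (Nat.zero_le p); rw [breakpoint_zero] at this; exact this.trans h1
  have hn : z ≤ n := by
    have := hm (Nat.succ_le_of_lt p.2)
    rw [breakpoint_last, sum_cell] at this; exact hz2.le.trans this
  have hlt := c.1.arc_lt hz1
  rw [h _ _ h0 (hz1.le.trans hn), h _ _ (h0.trans hz1.le) hn] at hlt
  -- Earlier arcs are counted completely at both `y` and `z`, later ones not at all, and arc `p`
  -- does not occur because its label is different.
  refine hlt.ne (Finset.sum_congr rfl fun q _ => ?_)
  split_ifs with hq
  · rcases lt_trichotomy q.1 p.1 with hqp | hqp | hqp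
    · have e1 := (hm (Nat.succ_le_of_lt hqp)).trans h1
      have e2 := (hm hqp.le).trans h1
      rw [min_eq_right e1, min_eq_right e2, min_eq_right (e1.trans hz1.le),
        min_eq_right (e2.trans hz1.le)]
    · exact absurd (by rw [← hq, Fin.ext hqp]) hne
    · have e1 := hz2.le.trans (hm (Nat.succ_le_of_lt hqp))
      have e2 := e1.trans (hm (Nat.le_succ q))
      rw [min_eq_left e1, min_eq_left e2, min_eq_left (hz1.le.trans e1),
        min_eq_left (hz1.le.trans e2)]
      ring
  · rfl

/-! ### Every normalized cactus lies in a cell -/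

/-- The perimeter of `c` between `0` and `T` consists of the `k` arcs between the points
`S 0 < … < S k`, with labels `w 0, …, w (k - 1)`, and adjacent arcs have different labels. -/
structure IsSubdivision (c : SpinelessCactus n) (T : ℝ) (k : ℕ) (w : ℕ → Fin n) (S : ℕ → ℝ) :
    Prop where
  zero : S 0 = 0
  last : S k = T
  lt : ∀ p < k, S p < S (p + 1)
  label : ∀ p < k, ∀ y, S p ≤ y → y < S (p + 1) → c.label y = w p
  reduced : ∀ p, p + 1 < k → w p ≠ w (p + 1)

/-- If the new piece has the label of the last arc, that arc is lengthened; otherwise a new arc is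
appended. This keeps adjacent labels different. -/
lemma IsSubdivision.extend {c : SpinelessCactus n} {T T' : ℝ} {w : ℕ → Fin n} {S : ℕ → ℝ}
    (h : IsSubdivision c T k w S) (hT : T < T') {j : Fin n}
    (hj : ∀ y, T ≤ y → y < T' → c.label y = j) :
    ∃ k w S, IsSubdivision c T' k w S := by
  -- The empty subdivision, which has no last arc, falls under the negative case.
  by_cases hk : ∃ q, k = q + 1 ∧ w q = j
  · obtain ⟨q, rfl, hq⟩ := hk
    refine ⟨q + 1, w, Function.update S (q + 1) T', ?_, by simp, fun p hp => ?_,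
      fun p hp y hy1 hy2 => ?_, h.reduced⟩
    · rw [Function.update_of_ne (by omega), h.zero]
    · rw [Function.update_of_ne (by omega)]
      rcases eq_or_ne p q with rfl | hpq
      · rw [Function.update_self]
        exact ((h.lt p hp).trans_eq h.last).trans hT
      · rw [Function.update_of_ne (by omega)]; exact h.lt p hp
    · rw [Function.update_of_ne (by omega)] at hy1
      rcases eq_or_ne p q with rfl | hpq
      · rw [Function.update_self] at hy2
        rcases lt_or_ge y T with hy | hy
        · exact h.label p hp y hy1 (by rwa [h.last])
        · rw [hj y hy hy2, hq]
      · rw [Function.update_of_ne (by omega)] at hy2; exact h.label p hp y hy1 hy2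
  · refine ⟨k + 1, Function.update w k j, Function.update S (k + 1) T', ?_, by simp,
      fun p hp => ?_, fun p hp y hy1 hy2 => ?_, fun p hp => ?_⟩
    · rw [Function.update_of_ne (by omega), h.zero]
    · rw [Function.update_of_ne (by omega)]
      rcases eq_or_ne p k with rfl | hpq
      · rw [Function.update_self, h.last]; exact hT
      · rw [Function.update_of_ne (by omega)]; exact h.lt p (by omega)
    · rw [Function.update_of_ne (by omega)] at hy1
      rcases eq_or_ne p k with rfl | hpq
      · rw [Function.update_self] at hy2 ⊢
        exact hj y (by rwa [h.last] at hy1) hy2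
      · rw [Function.update_of_ne (by omega)] at hy2 ⊢
        exact h.label p (by omega) y hy1 hy2
    · rw [Function.update_of_ne (by omega)]
      rcases eq_or_ne (p + 1) k with hpk | hpq
      · rw [hpk, Function.update_self]
        exact fun e => hk ⟨p, hpk.symm, e⟩
      · rw [Function.update_of_ne hpq]; exact h.reduced p (by omega)

/-- Continuous induction along the perimeter. The supremum of the endpoints that can be reached is
itself reached, because labels are constant just to the left of it; it cannot lie before the end,
because labels are constant just to the right of it. -/
lemma exists_isSubdivision (c : SpinelessCactus n) :
    ∃ k w S, IsSubdivision c c.perim k w S := by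
  set A : Set ℝ := {T | T ≤ c.perim ∧ ∃ k w S, IsSubdivision c T k w S} with hA
  have h0 : (0 : ℝ) ∈ A :=
    ⟨c.perim_pos.le, 0, fun _ => c.label 0, fun _ => 0, rfl, rfl, fun _ h => absurd h (by omega),
      fun _ h => absurd h (by omega), fun _ h => absurd h (by omega)⟩
  have hbd : BddAbove A := ⟨c.perim, fun T hT => hT.1⟩
  have hs : sSup A ≤ c.perim := csSup_le ⟨0, h0⟩ fun T hT => hT.1
  have hmem : sSup A ∈ A := by
    obtain ⟨j, hj⟩ := c.left (sSup A)
    obtain ⟨u, hu, hj⟩ := mem_nhdsLT_iff_exists_Ioo_subset.mp hj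
    obtain ⟨T, hT, huT⟩ := exists_lt_of_lt_csSup ⟨0, h0⟩ (show u < sSup A from hu)
    rcases (le_csSup hbd hT).eq_or_lt with e | hlt
    · rwa [← e]
    · obtain ⟨-, k, w, S, h⟩ := hT
      exact ⟨hs, h.extend hlt fun y h1 h2 => hj ⟨huT.trans_le h1, h2⟩⟩
  rcases hs.eq_or_lt with e | hlt
  · rw [← e]; exact hmem.2
  · exfalso
    obtain ⟨u, hu, hj⟩ := mem_nhdsGE_iff_exists_Ico_subset.mp (c.right (sSup A))
    obtain ⟨-, k, w, S, h⟩ := hmem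
    have hlt' : sSup A < min u c.perim := lt_min hu hlt
    have := h.extend hlt' fun y h1 h2 => hj ⟨h1, h2.trans_le (min_le_left _ _)⟩
    exact absurd (le_csSup hbd ⟨min_le_right _ _, this⟩) (not_le.mpr hlt')

/-- The pairs of consecutive letters are distinct: a repeated pair would give a pattern `a b … a b`
of interlaced letters. So `k - 1 ≤ n * n`, and there are only finitely many cells in each arity. -/
lemma IsTopType.length_le {w : Fin k → Fin n} (hw : IsTopType w) : k ≤ n * n + 1 := by
  by_contra hlt
  push Not at hlt
  obtain ⟨k, rfl⟩ : ∃ m, k = m + 1 := ⟨k - 1, by omega⟩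
  have hinj : Function.Injective fun p : Fin k => (w p.castSucc, w p.succ) := by
    intro p q hpq
    wlog hlt' : p < q generalizing p q
    · rcases (not_lt.mp hlt').eq_or_lt with e | h
      · exact e.symm
      · exact (this hpq.symm h).symm
    exfalso
    obtain ⟨h1, h2⟩ := Prod.mk.inj hpq
    have hp := hw.reduced p.castSucc p.succ (by simp)
    have hne : p.succ ≠ q.castSucc := by
      intro e
      rw [e] at hp
      exact hp h1
    have hlt2 : p.succ < q.castSucc := by
      refine lt_of_le_of_ne ?_ hne
      simp only [Fin.le_def, Fin.val_succ, Fin.val_castSucc]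
      exact hlt'
    exact hp (hw.noncrossing _ _ _ _ (Fin.castSucc_lt_succ) hlt2 (Fin.castSucc_lt_succ) h1 h2)
  have := Fintype.card_le_of_injective _ hinj
  simp only [Fintype.card_fin, Fintype.card_prod] at this
  omega

lemma exists_realizes (c : NormSpinelessCactus n) :
    ∃ (k : ℕ) (w : Fin k → Fin n) (_ : IsTopType w) (l : Cell w), Realizes w l c := by
  obtain ⟨k, w, S, h⟩ := exists_isSubdivision c.1
  have hmono : ∀ p q, p ≤ q → q ≤ k → S p ≤ S q := by
    intro p q hpq
    induction hpq with
    | refl => exact fun _ => le_rfl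
    | step _ ih => exact fun hq => (ih (by omega)).trans (h.lt _ (by omega)).le
  have hstrict : ∀ p q, p < q → q ≤ k → S p < S q := fun p q hpq hq =>
    (h.lt p (by omega)).trans_le (hmono _ _ hpq hq)
  have hlabel : ∀ p < k, c.1.label (S p) = w p := fun p hp => h.label p hp _ le_rfl (h.lt p hp)
  have hw : IsTopType fun p : Fin k => w p := by
    refine ⟨fun j => ?_, fun p q hpq => ?_, fun p q r s h1 h2 h3 h4 h5 => ?_⟩
    · obtain ⟨x, rfl⟩ := c.1.surj j
      obtain ⟨y, hy, hxy⟩ := (show Function.Periodic c.1.label c.1.perim from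
        c.1.periodic).exists_mem_Ico₀ c.1.perim_pos x
      rw [hxy]
      have hy2 : y < S k := by rw [h.last]; exact hy.2
      -- The first breakpoint beyond `y` is the right end of the arc that contains `y`; it is not
      -- the `0`-th since `S 0 = 0 ≤ y`.
      have hex : ∃ p, y < S p := ⟨k, hy2⟩
      have hle : Nat.find hex ≤ k := Nat.find_min' hex hy2
      have hne : Nat.find hex ≠ 0 := fun e => by
        have := Nat.find_spec hex
        rw [e, h.zero] at this
        exact absurd hy.1 (not_le.mpr this)
      obtain ⟨p, hp⟩ : ∃ p, Nat.find hex = p + 1 := ⟨Nat.find hex - 1, by omega⟩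
      refine ⟨⟨p, by omega⟩, (h.label p (by omega) y ?_ ?_).symm⟩
      · exact not_lt.mp (Nat.find_min hex (by omega))
      · rw [← hp]; exact Nat.find_spec hex
    · have := h.reduced p (by omega)
      rwa [hpq] at this
    -- The left endpoints of the arcs lie within one period, so that the noncrossing condition of
    -- the cactus applies to them.
    · have hk : S k = S 0 + c.1.perim := by rw [h.zero, h.last, zero_add]
      have := c.1.noncrossing (S p) (S q) (S r) (S s) (hstrict _ _ h1 q.2.le)
        (hstrict _ _ h2 r.2.le) (hstrict _ _ h3 s.2.le)
        ((hstrict s k s.2 le_rfl).trans_le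
          (hk.le.trans (by linarith [hmono 0 p (Nat.zero_le _) p.2.le])))
        (by rw [hlabel _ p.2, hlabel _ r.2]; exact h4)
        (by rw [hlabel _ q.2, hlabel _ s.2]; exact h5)
      rwa [hlabel _ p.2, hlabel _ q.2] at this
  have hbp : ∀ p ≤ k, breakpoint (fun q : Fin k => S (q + 1) - S q) p = S p := by
    intro p hp
    induction p with
    | zero => rw [breakpoint_zero, h.zero]
    | succ p ih =>
      have e : (Finset.univ.filter fun q : Fin k => q.1 < p + 1) =
          insert ⟨p, by omega⟩ (Finset.univ.filter fun q : Fin k => q.1 < p) := by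
        ext q
        simp only [Finset.mem_filter, Finset.mem_univ, true_and, Finset.mem_insert, Fin.ext_iff]
        omega
      rw [breakpoint, e, Finset.sum_insert (by simp), ← breakpoint, ih (by omega)]
      ring
  -- At the end of the perimeter no truncation is active, so the arc formula gives the radius of
  -- lobe `j`, which is one.
  have hl : ∀ j, ∑ p : Fin k with w p.1 = j, (S (p + 1) - S p) = 1 := by
    intro j
    have := arc_eq_sum_breakpoint c.1 w S (fun p hp => (h.lt p hp).le) h.zero h.label j
      (x := c.1.perim) c.1.perim_pos.le h.last.ge
    rw [← c.2 j, SpinelessCactus.radius, this, Finset.sum_filter]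
    refine Finset.sum_congr rfl fun p _ => ?_
    rw [← h.last, min_eq_right (hmono _ _ p.2 le_rfl), min_eq_right (hmono _ _ p.2.le le_rfl)]
  refine ⟨k, fun p => w p, hw, ⟨fun p => S (p + 1) - S p,
    fun p => sub_nonneg.mpr (h.lt p p.2).le, hl⟩, ?_⟩
  refine realizes_iff.mpr fun p y h1 h2 => ?_
  change breakpoint (fun q : Fin k => S (q + 1) - S q) p ≤ y at h1
  change y < breakpoint (fun q : Fin k => S (q + 1) - S q) (p + 1) at h2
  rw [hbp _ p.2.le] at h1
  rw [hbp _ p.2] at h2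
  exact h.label p p.2 y h1 h2

instance compactSpace_cell (w : Fin k → Fin n) : CompactSpace (Cell w) := by
  suffices h : IsCompact {l : Fin k → ℝ | (∀ p, 0 ≤ l p) ∧ ∀ j, ∑ p with w p = j, l p = 1} from
    isCompact_iff_compactSpace.mp h
  refine IsCompact.of_isClosed_subset (isCompact_Icc (a := (0 : Fin k → ℝ)) (b := 1)) ?_ ?_
  · simp only [ofPred_and, ofPred_forall]
    refine (isClosed_iInter fun p => ?_).inter (isClosed_iInter fun j => ?_)
    · exact isClosed_le continuous_const (continuous_apply p)
    · exact isClosed_eq (continuous_finsetSum _ fun p _ => continuous_apply p) continuous_const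
  · rintro l ⟨h0, h1⟩
    refine ⟨h0, fun p => ?_⟩
    change l p ≤ 1
    rw [← h1 (w p)]
    exact Finset.single_le_sum (fun q _ => h0 q) (by simp)

end Cells

/-- For a final topology it suffices to test on each cell. After subtracting `N` whole perimeters
the point lies in `[0, n]`, where the arc function is `cellArc`; each full turn contributes the
radius one. -/
lemma continuous_norm_arc {n : ℕ} (j : Fin n) (x : ℝ) :
    Continuous fun c : NormSpinelessCactus n => c.1.arc j x := by
  refine continuous_iSup_dom.2 fun k => continuous_iSup_dom.2 fun w => continuous_coinduced_dom.2 ?_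
  have hn : (0 : ℝ) < n := by exact_mod_cast j.pos
  set N : ℤ := ⌊x / n⌋
  have h1 : 0 ≤ x - N * n := by
    have := Int.floor_le (x / n)
    rw [le_div_iff₀ hn] at this
    linarith
  have h2 : x - N * n ≤ n := by
    have := Int.lt_floor_add_one (x / n)
    rw [div_lt_iff₀ hn] at this
    linarith
  have : (fun c : NormSpinelessCactus n => c.1.arc j x) ∘
      (fun z : {z : Cell w.1 × NormSpinelessCactus n // Realizes w.1 z.1 z.2} => z.1.2) =
      (fun l : Cell w.1 => cellArc w.1 l.1 j (x - N * n) + N) ∘ fun z => z.1.1 := by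
    funext z
    have := z.1.2.1.arc_add_int_perim j (x - N * n) N
    rw [z.1.2.2, perim_norm, sub_add_cancel, arc_eq_cellArc z.2 j h1 h2, mul_one] at this
    exact this
  rw [this]
  exact @Continuous.comp _ _ _ (TopologicalSpace.induced _ _) _ _ _ _
    ((cellArc_continuous w.1 j _).add continuous_const) continuous_induced_dom

/-- The topology of the CW complex of normalized spineless cacti is the topology of pointwise
convergence of the arc functions. -/
theorem topology_norm_eq (n : ℕ) :
    (inferInstance : TopologicalSpace (NormSpinelessCactus n)) =
      TopologicalSpace.induced (fun c (z : Fin n × ℝ) => c.1.arc z.1 z.2) inferInstance := by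
  refine le_antisymm (continuous_iff_le_induced.mp
    (continuous_pi fun z => continuous_norm_arc z.1 z.2)) ?_
  rw [TopologicalSpace.le_def]
  intro O hO
  rw [← @isClosed_compl_iff] at hO ⊢
  generalize Oᶜ = A at hO
  -- It remains to show that a set closed in the CW topology is closed under pointwise limits of arc
  -- functions. An ultrafilter on it is concentrated on one cell, its parameters converge there by
  -- compactness, and the limit parameter realizes the limit cactus.
  rw [@isClosed_iff_ultrafilter]
  intro c U hU hA
  rw [nhds_induced, ← tendsto_iff_comap, tendsto_pi_nhds] at hU
  have hcov : ∀ c : NormSpinelessCactus n,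
      ∃ v : (k : Fin (n * n + 2)) × {w : Fin k.1 → Fin n // IsTopType w},
        ∃ l : Cell v.2.1, Realizes v.2.1 l c := fun c => by
    obtain ⟨k, w, hw, l, h⟩ := exists_realizes c
    exact ⟨⟨⟨k, by have := hw.length_le; omega⟩, w, hw⟩, l, h⟩
  choose v l hl using hcov
  obtain ⟨⟨k, w⟩, hw⟩ := Ultrafilter.eq_pure_of_finite (U.map v)
  have hv : ∀ᶠ c in U, v c = ⟨k, w⟩ := by
    have : {(⟨k, w⟩ : (k : Fin (n * n + 2)) × {w : Fin k.1 → Fin n // IsTopType w})} ∈ U.map v := by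
      rw [hw]
      exact Set.mem_singleton _
    exact this
  obtain ⟨c₀, hc₀⟩ := hv.exists
  -- Cacti assigned to another cell form a set that `U` ignores; they receive the parameter of `c₀`
  -- as a default.
  have hex : ∀ c, ∃ l : Cell w.1, v c = ⟨k, w⟩ → Realizes w.1 l c := fun c => by
    by_cases hc : v c = ⟨k, w⟩
    · have := hl c
      revert this
      generalize l c = l'
      revert l'
      rw [hc]
      exact fun l' h => ⟨l', fun _ => h⟩
    · have l' := l c₀
      rw [hc₀] at l'
      exact ⟨l', fun h => absurd h hc⟩
  choose l' hl' using hex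
  have hlim := (U.map l').le_nhds_lim
  generalize (U.map l').lim = L at hlim
  have hlim' : Tendsto l' U (𝓝 L) := hlim
  have hreal : Realizes w.1 L c := by
    refine realizes_of_arc fun j (x : ℝ) hx0 hx => ?_
    refine tendsto_nhds_unique (hU (j, x))
      ((((cellArc_continuous w.1 j x).tendsto L).comp hlim').congr' ?_)
    filter_upwards [hv] with c' hc'
    exact (arc_eq_cellArc (hl' c' hc') j hx0 hx).symm
  -- The graph of the characteristic map carries the topology of the cell alone, so the preimage of
  -- `A` in it comes from a closed set `C` of parameters.
  have hcl := isClosed_iSup_iff.mp (isClosed_iSup_iff.mp hO k) w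
  rw [isClosed_coinduced, isClosed_induced_iff] at hcl
  obtain ⟨C, hC, hCA⟩ := hcl
  have hLC : L ∈ C := by
    refine hC.mem_of_tendsto hlim' ?_
    filter_upwards [hv, hA] with c' hc' hA'
    have : (⟨(l' c', c'), hl' c' hc'⟩ :
        {z : Cell w.1 × NormSpinelessCactus n // Realizes w.1 z.1 z.2}) ∈
        (fun z => z.1.1) ⁻¹' C := by rw [hCA]; exact hA'
    exact this
  have : (⟨(L, c), hreal⟩ : {z : Cell w.1 × NormSpinelessCactus n // Realizes w.1 z.1 z.2}) ∈
      (fun z => z.1.2) ⁻¹' A := by rw [← hCA]; exact hLC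
  exact this


/-! ### Continuity of maps into spaces of cacti -/

section Continuity

open SpinelessCactus

variable {Z : Type*} [TopologicalSpace Z] {m n k : ℕ}

lemma continuous_norm {f : Z → NormSpinelessCactus n}
    (h : ∀ j x, Continuous fun z => (f z).1.arc j x) : Continuous f := by
  have hi : IsInducing fun (c : NormSpinelessCactus n) (z : Fin n × ℝ) => c.1.arc z.1 z.2 :=
    ⟨topology_norm_eq n⟩
  exact hi.continuous_iff.mpr (continuous_pi fun z => h z.1 z.2)

/-- The error made by freezing the argument at `g z₀` is at most `|g z - g z₀|`, whatever the cactus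
is. -/
lemma continuous_arc_comp {f : Z → SpinelessCactus n}
    (h : ∀ j x, Continuous fun z => (f z).arc j x) (j : Fin n) {g : Z → ℝ} (hg : Continuous g) :
    Continuous fun z => (f z).arc j (g z) := by
  rw [continuous_iff_continuousAt]
  intro z₀
  have h1 : Tendsto (fun z => (f z).arc j (g z) - (f z).arc j (g z₀)) (𝓝 z₀) (𝓝 0) := by
    refine squeeze_zero_norm (a := fun z => |g z - g z₀|)
      (fun z => (f z).abs_arc_sub_le j _ _) ?_
    have : Continuous fun z => |g z - g z₀| := (hg.sub continuous_const).abs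
    simpa using this.tendsto z₀
  have h2 := h1.add ((h j (g z₀)).tendsto z₀)
  simpa [ContinuousAt] using h2

lemma continuous_coe_apply {t : Z → Fin n → PosReal} (ht : Continuous t) (j : Fin n) :
    Continuous fun z => (t z j : ℝ) :=
  continuous_subtype_val.comp ((continuous_apply j).comp ht)

lemma continuous_pi_posReal {t : Z → Fin n → PosReal} (ht : ∀ j, Continuous fun z => (t z j : ℝ)) :
    Continuous t :=
  continuous_pi fun j => Continuous.subtype_mk (ht j) fun z => (t z j).2

lemma continuous_arc_withRadii {f : Z → SpinelessCactus n} {t : Z → Fin n → PosReal}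
    (hr : ∀ j, Continuous fun z => (f z).radius j) (h : ∀ j x, Continuous fun z => (f z).arc j x)
    (ht : Continuous t) (j : Fin n) (y : ℝ) :
    Continuous fun z => ((f z).withRadii (t z)).arc j y := by
  have hratio : ∀ j, Continuous fun z => (t z j : ℝ) / (f z).radius j := fun j =>
    (continuous_coe_apply ht j).div (hr j) fun z => ((f z).radius_pos j).ne'
  have hst : ∀ x, Continuous fun z => (f z).stretch (t z) x := fun x =>
    continuous_finsetSum _ fun j _ => (hratio j).mul (h j x)
  -- The inverse stretch of `y` exceeds `a` iff `y` exceeds the stretch of `a`, so its continuity in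
  -- the parameter follows from that of the stretch at fixed points.
  have hinv : Continuous fun z => ((f z).stretchIso (t z)).symm y := by
    rw [continuous_iff_continuousAt]
    intro z₀
    refine tendsto_order.mpr ⟨fun a ha => ?_, fun a ha => ?_⟩
    · rw [OrderIso.lt_symm_apply] at ha
      filter_upwards [(hst a).tendsto z₀ |>.eventually_lt_const ha] with z hz
      rw [OrderIso.lt_symm_apply]; exact hz
    · replace ha := (OrderIso.symm_apply_lt _).mp ha
      filter_upwards [(hst a).tendsto z₀ |>.eventually_const_lt ha] with z hz
      rw [OrderIso.symm_apply_lt]; exact hz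
  have : (fun z => ((f z).withRadii (t z)).arc j y) = fun z =>
      (t z j : ℝ) / (f z).radius j * (f z).arc j (((f z).stretchIso (t z)).symm y) := by
    funext z
    rw [← arc_withRadii, ← stretchIso_apply, OrderIso.apply_symm_apply]
  rw [this]
  exact (hratio j).mul (continuous_arc_comp h j hinv)

/-! ### Cacti as normalized cacti with radii -/

lemma isInducing_normalize_radii :
    IsInducing fun c : SpinelessCactus n => (normalize c, c.radii) := ⟨rfl⟩

lemma continuous_normalize : Continuous (normalize : SpinelessCactus n → NormSpinelessCactus n) :=
  continuous_fst.comp isInducing_normalize_radii.continuous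

lemma continuous_radii : Continuous (radii : SpinelessCactus n → Fin n → PosReal) :=
  continuous_snd.comp isInducing_normalize_radii.continuous

lemma continuous_radius (j : Fin n) : Continuous fun c : SpinelessCactus n => c.radius j :=
  continuous_coe_apply continuous_radii j

lemma normalize_withRadii (c : SpinelessCactus n) (t : Fin n → PosReal) :
    normalize (c.withRadii t) = normalize c :=
  Subtype.ext (c.withRadii_withRadii t _)

lemma withRadii_normalize (c : SpinelessCactus n) (t : Fin n → PosReal) :
    (normalize c).1.withRadii t = c.withRadii t :=
  c.withRadii_withRadii _ t

lemma normalize_coe (c : NormSpinelessCactus n) : normalize c.1 = c :=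
  Subtype.ext (withRadii_eq_self c.2)

lemma continuous_arc (j : Fin n) (x : ℝ) : Continuous fun c : SpinelessCactus n => c.arc j x := by
  have : (fun c : SpinelessCactus n => c.arc j x) =
      fun c => ((normalize c).1.withRadii c.radii).arc j x := by
    funext c; rw [withRadii_normalize, withRadii_radii]
  rw [this]
  refine continuous_arc_withRadii (fun j => ?_) (fun j x => ?_) continuous_radii j x
  · simp only [fun c : SpinelessCactus n => (normalize c).2 j]
    exact continuous_const
  · exact (continuous_norm_arc j x).comp continuous_normalize

/-- A map into the space of spineless cacti is continuous if the radii and the arc functions depend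
continuously on the argument. -/
lemma continuous_cactus {f : Z → SpinelessCactus n} (hr : ∀ j, Continuous fun z => (f z).radius j)
    (h : ∀ j x, Continuous fun z => (f z).arc j x) : Continuous f := by
  refine continuous_induced_rng.mpr (Continuous.prodMk (continuous_norm fun j x => ?_)
    (continuous_pi_posReal hr))
  exact continuous_arc_withRadii hr h continuous_const j x

lemma continuous_norm_val : Continuous fun c : NormSpinelessCactus n => c.1 := by
  refine continuous_cactus (fun j => ?_) continuous_norm_arc
  simp only [fun c : NormSpinelessCactus n => c.2 j]
  exact continuous_const

lemma continuous_arc_apply {f : Z → SpinelessCactus n} (hf : Continuous f) (j : Fin n) {g : Z → ℝ}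
    (hg : Continuous g) : Continuous fun z => (f z).arc j (g z) :=
  continuous_arc_comp (fun j x => (continuous_arc j x).comp hf) j hg

lemma continuous_perim : Continuous fun c : SpinelessCactus n => c.perim := by
  simp only [← sum_radius]
  exact continuous_finsetSum _ fun j _ => continuous_radius j

lemma continuous_withRadii {f : Z → SpinelessCactus n} {t : Z → Fin n → PosReal}
    (hf : Continuous f) (ht : Continuous t) : Continuous fun z => (f z).withRadii (t z) := by
  refine continuous_cactus (fun j => ?_) (continuous_arc_withRadii
    (fun j => (continuous_radius j).comp hf) (fun j x => (continuous_arc j x).comp hf) ht)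
  simp only [radius_withRadii]
  exact continuous_coe_apply ht j

lemma continuous_scaleLobe {f : Z → SpinelessCactus n} {t : Z → PosReal} (hf : Continuous f)
    (i : Fin n) (ht : Continuous t) : Continuous fun z => (f z).scaleLobe i (t z) :=
  continuous_withRadii hf ((continuous_radii.comp hf).update i ht)

lemma continuous_relabel (σ : Equiv.Perm (Fin n)) :
    Continuous (relabel σ : SpinelessCactus n → SpinelessCactus n) := by
  refine continuous_cactus (fun j => ?_) (fun j x => ?_)
  · simp only [radius_relabel]; exact continuous_radius _
  · simp only [arc_relabel]; exact continuous_arc _ _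

lemma continuous_glue (h : m + n = k) (i : Fin (m + 1)) {f : Z → SpinelessCactus (m + 1)}
    {θ : Z → ℝ} {g : Z → SpinelessCactus (n + 1)} (hf : Continuous f) (hθ : Continuous θ)
    (hg : Continuous g) : Continuous fun z => glue h i (f z) (θ z) (g z) := by
  have hr : Continuous fun z => (f z).radius i := (continuous_radius i).comp hf
  have hp : Continuous fun z => (g z).perim := continuous_perim.comp hg
  have hrp : Continuous fun z => (f z).radius i / (g z).perim :=
    hr.div hp fun z => (g z).perim_pos.ne'
  have hpos : ∀ x, Continuous fun z => (f z).pos i (θ z) (g z) x := fun x =>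
    hp.mul (((continuous_arc_apply hf i continuous_const).div hr
      fun z => ((f z).radius_pos i).ne').sub hθ)
  refine continuous_cactus (fun l => ?_) (fun l x => ?_)
  · obtain ⟨z, rfl⟩ := (insertEquiv h i).surjective l
    rcases z with a | b
    · simp only [radius_glue_inl]; exact (continuous_radius _).comp hf
    · simp only [radius_glue_inr]; exact hrp.mul ((continuous_radius _).comp hg)
  · obtain ⟨z, rfl⟩ := (insertEquiv h i).surjective l
    rcases z with a | b
    · simp only [arc_glue_inl]; exact (continuous_arc _ _).comp hf
    · simp only [arc_glue_inr]
      exact hrp.mul ((continuous_arc_apply hg b (hpos x)).sub (continuous_arc_apply hg b (hpos 0)))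

/-! ### Circle coordinates -/

lemma coe_lift (ζ : UnitAddCircle) : ((lift ζ : ℝ) : UnitAddCircle) = ζ :=
  AddCircle.coe_equivIco (p := (1 : ℝ)) (a := 0)

lemma exists_int_of_coe_eq {x y : ℝ} (h : (x : UnitAddCircle) = y) : ∃ N : ℤ, x = y + N := by
  obtain ⟨N, hN⟩ := (QuotientAddGroup.eq_iff_sub_mem.mp h)
  refine ⟨N, ?_⟩
  simp only [zsmul_eq_mul, mul_one] at hN
  linarith

lemma coe_add_int (x : ℝ) (N : ℤ) : ((x + N : ℝ) : UnitAddCircle) = x := by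
  refine QuotientAddGroup.eq_iff_sub_mem.mpr ⟨N, ?_⟩
  simp

/-- A continuous function of a real parameter that is periodic with period one is a continuous
function on the circle. -/
lemma continuous_comp_lift {W : Type*} [TopologicalSpace W] {F : Z → ℝ → W}
    (hF : Continuous fun p : Z × ℝ => F p.1 p.2) (hper : ∀ z θ (N : ℤ), F z (θ + N) = F z θ) :
    Continuous fun p : Z × UnitAddCircle => F p.1 (lift p.2) := by
  -- `lift` jumps at the origin of the circle, so continuity is tested upstairs on `ℝ`. The covering
  -- map is open, hence its product with the identity is again a quotient map.
  have hq : IsOpenQuotientMap (Prod.map id fun x : ℝ => (x : UnitAddCircle) : Z × ℝ → _) :=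
    IsOpenQuotientMap.id.prodMap QuotientAddGroup.isOpenQuotientMap_mk
  rw [hq.isQuotientMap.continuous_iff]
  convert hF using 1
  funext p
  obtain ⟨N, hN⟩ := exists_int_of_coe_eq (coe_lift (p.2 : UnitAddCircle))
  simp only [Function.comp_apply, Prod.map_fst, Prod.map_snd, id, hN, hper]

lemma continuous_glue_lift (h : m + n = k) (i : Fin (m + 1)) {f : Z → SpinelessCactus (m + 1)}
    {ζ : Z → UnitAddCircle} {g : Z → SpinelessCactus (n + 1)} (hf : Continuous f)
    (hζ : Continuous ζ) (hg : Continuous g) :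
    Continuous fun z => glue h i (f z) (lift (ζ z)) (g z) :=
  (continuous_comp_lift (F := fun (z : Z) θ => glue h i (f z) θ (g z))
    (continuous_glue h i (hf.comp continuous_fst) continuous_snd (hg.comp continuous_fst))
    (fun _ θ N => glue_add_int h i _ θ N _)).comp (continuous_id.prodMk hζ)

/-! ### Local zeros of glued cacti -/

lemma glueSpines_inl (h : m + n = k) (i : Fin (m + 1)) (ζ : Fin (m + 1) → UnitAddCircle)
    (d : SpinelessCactus (n + 1)) (ξ : Fin (n + 1) → UnitAddCircle)
    (a : {a : Fin (m + 1) // a ≠ i}) :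
    glueSpines h i ζ d ξ (insertEquiv h i (Sum.inl a)) = ζ a := by
  simp [glueSpines]

lemma glueSpines_inr (h : m + n = k) (i : Fin (m + 1)) (ζ : Fin (m + 1) → UnitAddCircle)
    (d : SpinelessCactus (n + 1)) (ξ : Fin (n + 1) → UnitAddCircle) (b : Fin (n + 1)) :
    glueSpines h i ζ d ξ (insertEquiv h i (Sum.inr b)) =
      ξ b - ((d.arc b (-(d.perim * lift (ζ i))) / d.radius b : ℝ) : UnitAddCircle) := by
  simp [glueSpines]

lemma continuous_glueSpines (h : m + n = k) (i : Fin (m + 1))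
    {ζ : Z → Fin (m + 1) → UnitAddCircle} {g : Z → SpinelessCactus (n + 1)}
    {ξ : Z → Fin (n + 1) → UnitAddCircle} (hζ : Continuous ζ) (hg : Continuous g)
    (hξ : Continuous ξ) : Continuous fun z => glueSpines h i (ζ z) (g z) (ξ z) := by
  refine continuous_pi fun l => ?_
  obtain ⟨z, rfl⟩ := (insertEquiv h i).surjective l
  rcases z with a | b
  · simp only [glueSpines_inl]
    exact (continuous_apply _).comp hζ
  · simp only [glueSpines_inr]
    refine ((continuous_apply b).comp hξ).sub ?_
    refine (continuous_comp_lift (Z := Z)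
      (F := fun z θ => (((g z).arc b (-((g z).perim * θ)) / (g z).radius b : ℝ) : UnitAddCircle))
      ?_ fun z θ N => ?_).comp (continuous_id.prodMk ((continuous_apply i).comp hζ))
    · refine (AddCircle.continuous_mk' 1).comp (Continuous.div ?_ ?_ fun z =>
        ((g z.1).radius_pos b).ne')
      · exact continuous_arc_apply (hg.comp continuous_fst) b
          (((continuous_perim.comp (hg.comp continuous_fst)).mul continuous_snd).neg)
      · exact (continuous_radius b).comp (hg.comp continuous_fst)
    · have hr := ((g z).radius_pos b).ne'
      have : -((g z).perim * (θ + N)) = -((g z).perim * θ) + (-N : ℤ) * (g z).perim := by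
        push_cast; ring
      simp only [this, arc_add_int_perim, add_div, mul_div_cancel_right₀ _ hr, coe_add_int]

lemma permute_continuous {S : Type} [TopologicalSpace S] (σ : Equiv.Perm (Fin n)) :
    Continuous (permute σ : (Fin n → S) → Fin n → S) :=
  continuous_pi fun _ => continuous_apply _

lemma permute_apply_self {S : Type} (σ : Equiv.Perm (Fin n)) (f : Fin n → S) (j : Fin n) :
    permute σ f (σ j) = f j := by
  simp [permute]

lemma glueSpines_permute (h : m + n = k) (i : Fin (m + 1)) (σ : Equiv.Perm (Fin (m + 1)))
    (τ : Equiv.Perm (Fin (n + 1))) (ζ : Fin (m + 1) → UnitAddCircle) (d : SpinelessCactus (n + 1))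
    (ξ : Fin (n + 1) → UnitAddCircle) :
    glueSpines h (σ i) (permute σ ζ) (d.relabel τ) (permute τ ξ) =
      permute (blockPerm h i σ τ) (glueSpines h i ζ d ξ) := by
  refine eq_permute_blockPerm h i σ τ (fun a => ?_) (fun b => ?_)
  · rw [glueSpines_inl, glueSpines_inl, permute_apply_self]
  · rw [glueSpines_inr, glueSpines_inr, permute_apply_self, permute_apply_self, arc_relabel,
      radius_relabel, Equiv.Perm.inv_def, Equiv.symm_apply_apply]
    rfl

/-- The angles in iterated gluings are compatible. -/
lemma exists_int_lift (ζ ξ : UnitAddCircle) {d : SpinelessCactus n} (b : Fin n) :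
    ∃ N : ℤ, lift (ξ - ((d.arc b (-(d.perim * lift ζ)) / d.radius b : ℝ) : UnitAddCircle)) =
      lift ξ - d.arc b (-(d.perim * lift ζ)) / d.radius b + N := by
  refine exists_int_of_coe_eq ?_
  rw [coe_lift, AddCircle.coe_sub, coe_lift]

lemma glueSpines_assoc_seq {k l m p q r : ℕ} (h₁ : k + l = p) (h₂ : p + m = r) (h₃ : l + m = q)
    (h₄ : k + q = r) (i : Fin (k + 1)) (b : Fin (l + 1)) (ζ : Fin (k + 1) → UnitAddCircle)
    (d : SpinelessCactus (l + 1)) (ξ : Fin (l + 1) → UnitAddCircle)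
    (e : SpinelessCactus (m + 1)) (η : Fin (m + 1) → UnitAddCircle) :
    glueSpines h₂ (insertEquiv h₁ i (Sum.inr b)) (glueSpines h₁ i ζ d ξ) e η =
      glueSpines h₄ i ζ (glue h₃ b d (lift (ξ b)) e) (glueSpines h₃ b ξ e η) := by
  refine funext_insert h₄ i (fun a => ?_) fun j => ?_
  · rw [← insertEquiv_seq_inl h₁ h₂ h₃ h₄ i b a (insertEquiv_inr_ne_inl h₁ i b a).symm,
      glueSpines_inl, insertEquiv_seq_inl h₁ h₂ h₃ h₄ i b a, glueSpines_inl, glueSpines_inl]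
  · obtain ⟨z, rfl⟩ := (insertEquiv h₃ b).surjective j
    rcases z with b' | j
    · rw [← insertEquiv_seq_inr h₁ h₂ h₃ h₄ i b b' (insertEquiv_inr_ne h₁ i b'.2), glueSpines_inl,
        insertEquiv_seq_inr h₁ h₂ h₃ h₄ i b b', glueSpines_inr, glueSpines_inr, glueSpines_inl,
        arc_glue_inl, radius_glue_inl]
      rfl
    · rw [← insertEquiv_inr_inr h₁ h₂ h₃ h₄ i b j, glueSpines_inr,
        insertEquiv_inr_inr h₁ h₂ h₃ h₄ i b j, glueSpines_inr, glueSpines_inr, glueSpines_inr]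
      obtain ⟨N, hN⟩ := exists_int_lift (ζ i) (ξ b) (d := d) b
      rw [hN, sub_sub, ← AddCircle.coe_add, sub_right_inj, arc_glue_inr, radius_glue_inr, pos_zero]
      have hr := (e.radius_pos j).ne'
      have hp := e.perim_pos.ne'
      have hd := (d.radius_pos b).ne'
      -- Both bracketings lead to the same point of the outside circle of `e`, up to `N` whole
      -- turns. The two successive changes of origin on the right-hand side then telescope by
      -- `arc_glue_inr`.
      have h1 : -(e.perim * (lift (ξ b) - d.arc b (-(d.perim * lift (ζ i))) / d.radius b + N)) =
          d.pos b (lift (ξ b)) e (-(d.perim * lift (ζ i))) + (-N : ℤ) * e.perim := by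
        simp only [pos]; push_cast; ring
      rw [h1, arc_add_int_perim, add_div, mul_div_cancel_right₀ _ hr, coe_add_int]
      congr 1
      change _ = _ + d.radius b / e.perim * (e.arc j (d.pos b (lift (ξ b)) e
        (-(d.perim * lift (ζ i)))) - _) / _
      field_simp
      ring

lemma glueSpines_assoc_par {k l m p q r : ℕ} (h₁ : k + l = p) (h₂ : p + m = r) (h₃ : k + m = q)
    (h₄ : q + l = r) (i a : Fin (k + 1)) (hai : a ≠ i) (ζ : Fin (k + 1) → UnitAddCircle)
    (d : SpinelessCactus (l + 1)) (ξ : Fin (l + 1) → UnitAddCircle)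
    (e : SpinelessCactus (m + 1)) (η : Fin (m + 1) → UnitAddCircle) :
    glueSpines h₂ (insertEquiv h₁ i (Sum.inl ⟨a, hai⟩)) (glueSpines h₁ i ζ d ξ) e η =
      glueSpines h₄ (insertEquiv h₃ a (Sum.inl ⟨i, hai.symm⟩)) (glueSpines h₃ a ζ e η) d ξ := by
  refine funext_insert h₂ (insertEquiv h₁ i (Sum.inl ⟨a, hai⟩)) (fun ⟨j, hj⟩ => ?_) fun e' => ?_
  · obtain ⟨z, rfl⟩ := (insertEquiv h₁ i).surjective j
    rcases z with ⟨a', ha'⟩ | b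
    · have hne : a' ≠ a := fun e => hj (by subst e; rfl)
      rw [glueSpines_inl, insertEquiv_par_inl h₁ h₂ h₃ h₄ i a a' hai ha' hne hj
        (insertEquiv_inl_ne h₃ a fun e => ha' (congrArg Subtype.val e)), glueSpines_inl,
        glueSpines_inl, glueSpines_inl]
    · rw [glueSpines_inl, ← insertEquiv_par_inr h₃ h₄ h₁ h₂ a i hai.symm b hj, glueSpines_inr,
        glueSpines_inr, glueSpines_inl]
  · rw [glueSpines_inr, insertEquiv_par_inr h₁ h₂ h₃ h₄ i a hai e' (insertEquiv_inr_ne_inl h₃ a _ _),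
      glueSpines_inl, glueSpines_inl, glueSpines_inr]

end Continuity


open SpinelessCactus

/-! ### General facts about operads -/

/-- Transport of structure: the composition of `Q` is the conjugate of that of `P`. It yields the
associativity of the semi-direct products from that of the cactus operads. -/
lemma IsOperad.of_iso {X Y : SymSpaces} {P : Compositions X} {Q : Compositions Y}
    (hP : IsOperad P) {f : ∀ n, X.space n → Y.space n} {g : ∀ n, Y.space n → X.space n}
    (hf : IsMorphism P Q f) (hg : ∀ n, Continuous (g n)) (hgf : ∀ n x, g n (f n x) = x)
    (hfg : ∀ n y, f n (g n y) = y) : IsMorphism Q P g ∧ IsOperad Q := by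
  have hact : ∀ n σ y, g n (Y.act n σ y) = X.act n σ (g n y) := fun n σ y => by
    rw [← hgf n (X.act n σ (g n y)), hf.map_act, hfg]
  have hcomp : ∀ {m n k : ℕ} (h : m + n = k) (i : Fin (m + 1)) (x : Y.space m) (y : Y.space n),
      Q.comp h i x y = f k (P.comp h i (g m x) (g n y)) := fun h i x y => by
    rw [hf.map_comp, hfg, hfg]
  refine ⟨⟨hg, hact, fun h i x y => by rw [hcomp, hgf]⟩, ⟨⟨fun n σ => ?_, fun h i => ?_,
    fun h i σ τ x y => ?_⟩, fun h₁ h₂ h₃ h₄ i b x y z => ?_,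
    fun h₁ h₂ h₃ h₄ i a hai x y z => ?_⟩⟩
  · have : Y.act n σ = f n ∘ X.act n σ ∘ g n := by
      funext y; simp only [Function.comp_apply, hf.map_act, hfg]
    rw [this]
    exact (hf.continuous n).comp ((hP.continuous_act n σ).comp (hg n))
  · simp only [hcomp]
    exact (hf.continuous _).comp ((hP.continuous_comp h i).comp ((hg _).prodMap (hg _)))
  · rw [hcomp, hact, hact, hP.equivariant, hf.map_act, ← hcomp]
  · simp only [hcomp, hgf]
    rw [hP.assoc_seq h₁ h₂ h₃ h₄]
  · simp only [hcomp, hgf]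
    rw [hP.assoc_par h₁ h₂ h₃ h₄ i a hai]

lemma Compositions.eq_of_comp {X : SymSpaces} {P Q : Compositions X}
    (h : ∀ {m n k : ℕ} (h : m + n = k) (i : Fin (m + 1)) (x : X.space m) (y : X.space n),
      P.comp h i x y = Q.comp h i x y) : P = Q := by
  cases P
  cases Q
  congr
  funext m n k h' i x y
  exact h h' i x y

lemma isomorphic_directProduct_comm {X Y : SymSpaces} (P : Compositions X) (Q : Compositions Y) :
    Isomorphic (directProduct P Q) (directProduct Q P) :=
  ⟨fun _ z => (z.2, z.1), fun _ z => (z.2, z.1),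
    ⟨fun _ => continuous_snd.prodMk continuous_fst, fun _ _ _ => rfl, fun _ _ _ _ => rfl⟩,
    ⟨fun _ => continuous_snd.prodMk continuous_fst, fun _ _ _ => rfl, fun _ _ _ _ => rfl⟩,
    fun _ _ => rfl, fun _ _ => rfl⟩

/-! ### The scaling operad -/

section Scaling

variable {m n k : ℕ}

/-- The composition of the scaling operad, on tuples. -/
def scale (h : m + n = k) (i : Fin (m + 1)) (r : Fin (m + 1) → PosReal)
    (r' : Fin (n + 1) → PosReal) : Fin (k + 1) → PosReal := scaling.comp h i r r'

lemma scale_inl (h : m + n = k) (i : Fin (m + 1)) (r : Fin (m + 1) → PosReal)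
    (r' : Fin (n + 1) → PosReal) (a : {a : Fin (m + 1) // a ≠ i}) :
    scale h i r r' (insertEquiv h i (Sum.inl a)) = r a := by
  simp [scale, scaling]

lemma scale_inr (h : m + n = k) (i : Fin (m + 1)) (r : Fin (m + 1) → PosReal)
    (r' : Fin (n + 1) → PosReal) (b : Fin (n + 1)) :
    (scale h i r r' (insertEquiv h i (Sum.inr b)) : ℝ) =
      (r i : ℝ) / (total r' : ℝ) * r' b := by
  simp [scale, scaling]

lemma coe_total (r : Fin (n + 1) → PosReal) : (total r : ℝ) = ∑ j, (r j : ℝ) := rfl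

/-- The inserted block is normalized to have sum `r i`, the entry it replaces. In iterated
compositions this identifies the denominators. -/
lemma total_scale (h : m + n = k) (i : Fin (m + 1)) (r : Fin (m + 1) → PosReal)
    (r' : Fin (n + 1) → PosReal) : total (scale h i r r') = total r := by
  ext
  have h1 : (∑ a : {a : Fin (m + 1) // a ≠ i}, (r a : ℝ)) + r i = ∑ j, (r j : ℝ) := by
    rw [← Fintype.sum_subtype_add_sum_subtype (fun a => a ≠ i) (fun a => (r a : ℝ))]
    congr 1
    exact (Fintype.sum_eq_single (f := fun x : {a // ¬ a ≠ i} => (r x : ℝ)) ⟨i, not_not.mpr rfl⟩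
      fun x hx => absurd (Subtype.ext (not_not.mp x.2)) hx).symm
  rw [coe_total, coe_total, sum_insert h i]
  simp only [scale_inl, scale_inr]
  rw [← Finset.mul_sum, ← coe_total r', div_mul_cancel₀ _ (total r').2.ne', h1]

lemma total_permute (σ : Equiv.Perm (Fin (n + 1))) (r : Fin (n + 1) → PosReal) :
    total (permute σ r) = total r :=
  Subtype.ext (Equiv.sum_comp σ⁻¹ fun j => (r j : ℝ))

lemma continuous_total : Continuous (total : (Fin (n + 1) → PosReal) → PosReal) :=
  Continuous.subtype_mk (continuous_finsetSum _ fun j _ => continuous_coe_apply continuous_id j) _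

lemma continuous_scale (h : m + n = k) (i : Fin (m + 1)) :
    Continuous fun z : (Fin (m + 1) → PosReal) × (Fin (n + 1) → PosReal) =>
      scale h i z.1 z.2 := by
  refine continuous_pi_posReal fun l => ?_
  obtain ⟨z, rfl⟩ := (insertEquiv h i).surjective l
  rcases z with a | b
  · simp only [scale_inl]
    exact continuous_coe_apply continuous_fst _
  · simp only [scale_inr]
    exact ((continuous_coe_apply continuous_fst i).div
      (continuous_subtype_val.comp (continuous_total.comp continuous_snd))
      fun z => (total z.2).2.ne').mul (continuous_coe_apply continuous_snd b)

lemma scale_permute (h : m + n = k) (i : Fin (m + 1)) (σ : Equiv.Perm (Fin (m + 1)))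
    (τ : Equiv.Perm (Fin (n + 1))) (r : Fin (m + 1) → PosReal) (r' : Fin (n + 1) → PosReal) :
    scale h (σ i) (permute σ r) (permute τ r') = permute (blockPerm h i σ τ) (scale h i r r') := by
  refine eq_permute_blockPerm h i σ τ (fun a => ?_) (fun b => ?_)
  · rw [scale_inl, scale_inl, permute_apply_self]
  · ext
    rw [scale_inr, scale_inr, permute_apply_self, permute_apply_self, total_permute]

lemma scale_assoc_seq {k l m p q r : ℕ} (h₁ : k + l = p) (h₂ : p + m = r) (h₃ : l + m = q)
    (h₄ : k + q = r) (i : Fin (k + 1)) (b : Fin (l + 1)) (x : Fin (k + 1) → PosReal)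
    (y : Fin (l + 1) → PosReal) (z : Fin (m + 1) → PosReal) :
    scale h₂ (insertEquiv h₁ i (Sum.inr b)) (scale h₁ i x y) z =
      scale h₄ i x (scale h₃ b y z) := by
  refine funext_insert h₄ i (fun a => ?_) fun j => ?_
  · rw [scale_inl, ← insertEquiv_seq_inl h₁ h₂ h₃ h₄ i b a
      (insertEquiv_inr_ne_inl h₁ i b a).symm, scale_inl, scale_inl]
  · obtain ⟨w, rfl⟩ := (insertEquiv h₃ b).surjective j
    ext
    rw [scale_inr, total_scale]
    rcases w with b' | j
    · rw [← insertEquiv_seq_inr h₁ h₂ h₃ h₄ i b b' (insertEquiv_inr_ne h₁ i b'.2), scale_inl,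
        scale_inr, scale_inl]
    · rw [← insertEquiv_inr_inr h₁ h₂ h₃ h₄ i b j, scale_inr, scale_inr, scale_inr]
      ring

lemma scale_assoc_par {k l m p q r : ℕ} (h₁ : k + l = p) (h₂ : p + m = r) (h₃ : k + m = q)
    (h₄ : q + l = r) (i a : Fin (k + 1)) (hai : a ≠ i) (x : Fin (k + 1) → PosReal)
    (y : Fin (l + 1) → PosReal) (z : Fin (m + 1) → PosReal) :
    scale h₂ (insertEquiv h₁ i (Sum.inl ⟨a, hai⟩)) (scale h₁ i x y) z =
      scale h₄ (insertEquiv h₃ a (Sum.inl ⟨i, hai.symm⟩)) (scale h₃ a x z) y := by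
  refine funext_insert h₂ (insertEquiv h₁ i (Sum.inl ⟨a, hai⟩)) (fun ⟨j, hj⟩ => ?_) fun e' => ?_
  · obtain ⟨w, rfl⟩ := (insertEquiv h₁ i).surjective j
    rcases w with ⟨a', ha'⟩ | b
    · have hne : a' ≠ a := fun e => hj (by subst e; rfl)
      rw [scale_inl, insertEquiv_par_inl h₁ h₂ h₃ h₄ i a a' hai ha' hne hj
        (insertEquiv_inl_ne h₃ a fun e => ha' (congrArg Subtype.val e)), scale_inl,
        scale_inl, scale_inl]
    · ext
      rw [scale_inl, ← insertEquiv_par_inr h₃ h₄ h₁ h₂ a i hai.symm b hj, scale_inr,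
        scale_inr, scale_inl]
  · ext
    rw [scale_inr, insertEquiv_par_inr h₁ h₂ h₃ h₄ i a hai e' (insertEquiv_inr_ne_inl h₃ a _ _),
      scale_inl, scale_inl, scale_inr]

lemma isOperad_scaling : IsOperad scaling where
  continuous_act _ σ := permute_continuous σ
  continuous_comp := continuous_scale
  equivariant := scale_permute
  assoc_seq := scale_assoc_seq
  assoc_par := scale_assoc_par

/-- The vector with all entries one. -/
def unitRadii (n : ℕ) : Fin n → PosReal := fun _ => ⟨1, one_pos⟩

/-- The segment from `r` to the vector with all entries one. -/
def towardsUnit (t : unitInterval) (r : Fin n → PosReal) : Fin n → PosReal := fun j =>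
  ⟨(1 - t) * r j + t, by
    have h1 : (0 : ℝ) ≤ (1 - (t : ℝ)) * r j := mul_nonneg (sub_nonneg.mpr t.2.2) (r j).2.le
    -- At `t = 0` positivity comes from `r j`, for `t > 0` from the summand `t`.
    rcases t.2.1.eq_or_lt with h | h
    · rw [← h]; simpa using (r j).2
    · linarith⟩

lemma towardsUnit_zero (r : Fin n → PosReal) : towardsUnit 0 r = r := by
  funext j; ext; simp [towardsUnit]

lemma towardsUnit_one (r : Fin n → PosReal) : towardsUnit 1 r = unitRadii n := by
  funext j; ext; simp [towardsUnit, unitRadii]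

lemma continuous_towardsUnit :
    Continuous fun z : unitInterval × (Fin n → PosReal) => towardsUnit z.1 z.2 :=
  continuous_pi_posReal fun j =>
    ((continuous_const.sub (continuous_subtype_val.comp continuous_fst)).mul
      (continuous_coe_apply continuous_snd j)).add (continuous_subtype_val.comp continuous_fst)

variable {Y : SymSpaces}

/-- The perturbed compositions at the vector of ones form a quasi-operad. -/
lemma IsPerturbed.isQuasiOperad {B : Perturbed scalingSpaces Y} (hB : IsPerturbed B)
    (hact : ∀ n σ, Continuous (Y.act n σ)) {Q : Compositions Y}
    (hQ : ∀ {m n k : ℕ} (h : m + n = k) (i : Fin (m + 1)) (y : Y.space m) (y' : Y.space n),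
      B.comp h i y (unitRadii (n + 1)) y' = Q.comp h i y y') : IsQuasiOperad Q where
  continuous_act := hact
  continuous_comp {m n k} h i := by
    simp only [← hQ]
    exact (hB.continuous_comp h i).comp
      (continuous_fst.prodMk (continuous_const.prodMk continuous_snd))
  equivariant {m n k} h i σ τ y y' := by
    rw [← hQ, ← hQ]
    exact hB.equivariant h i σ τ y (unitRadii (n + 1)) y'

/-- The semi-direct product is deformed into the direct product by moving the perturbation to the
vector of ones. -/
lemma IsPerturbed.homotopyEquivalent {B : Perturbed scalingSpaces Y} (hB : IsPerturbed B)
    (hact : ∀ n σ, Continuous (Y.act n σ)) {Q : Compositions Y}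
    (hQ : ∀ {m n k : ℕ} (h : m + n = k) (i : Fin (m + 1)) (y : Y.space m) (y' : Y.space n),
      B.comp h i y (unitRadii (n + 1)) y' = Q.comp h i y y') :
    HomotopyEquivalent (rightSemidirectProduct scaling B) (directProduct scaling Q) := by
  let H : unitInterval → Compositions (prodSpaces scalingSpaces Y) := fun t =>
    { comp := fun h i z w => (scaling.comp h i z.1 w.1, B.comp h i z.2 (towardsUnit t w.1) w.2) }
  have hH : ∀ {m n k : ℕ} (h : m + n = k) (i : Fin (m + 1)),
      Continuous fun z : unitInterval × (prodSpaces scalingSpaces Y).space m ×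
        (prodSpaces scalingSpaces Y).space n => (H z.1).comp h i z.2.1 z.2.2 := by
    intro m n k h i
    have e1 : Continuous fun z : unitInterval × (prodSpaces scalingSpaces Y).space m ×
        (prodSpaces scalingSpaces Y).space n => (z.2.1.1, z.2.2.1) :=
      (continuous_fst.comp (continuous_fst.comp continuous_snd)).prodMk
        (continuous_fst.comp (continuous_snd.comp continuous_snd))
    have e2 : Continuous fun z : unitInterval × (prodSpaces scalingSpaces Y).space m ×
        (prodSpaces scalingSpaces Y).space n => (z.2.1.2, towardsUnit z.1 z.2.2.1, z.2.2.2) :=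
      (continuous_snd.comp (continuous_fst.comp continuous_snd)).prodMk
        ((continuous_towardsUnit.comp (continuous_fst.prodMk
          (continuous_fst.comp (continuous_snd.comp continuous_snd)))).prodMk
          (continuous_snd.comp (continuous_snd.comp continuous_snd)))
    exact ((isOperad_scaling.continuous_comp h i).comp e1).prodMk ((hB.continuous_comp h i).comp e2)
  refine ⟨H, ?_, ?_, fun t => ⟨fun n σ => ?_, fun {m n k} h i => ?_, fun {m n k} h i σ τ x y => ?_⟩,
    hH⟩
  · exact Compositions.eq_of_comp fun h i z w =>
      Prod.ext rfl (congrArg (fun r => B.comp h i z.2 r w.2) (towardsUnit_zero w.1))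
  · exact Compositions.eq_of_comp fun h i z w =>
      Prod.ext rfl ((congrArg (fun r => B.comp h i z.2 r w.2) (towardsUnit_one w.1)).trans
        (hQ h i z.2 w.2))
  · exact (isOperad_scaling.continuous_act n σ).prodMap (hact n σ)
  · exact (hH h i).comp (continuous_const.prodMk continuous_id)
  -- Moving towards the ones is done entry by entry, so it commutes with permutations by definition.
  · exact Prod.ext (isOperad_scaling.equivariant h i σ τ x.1 y.1)
      (hB.equivariant h i σ τ x.2 (towardsUnit t y.1) y.2)

/-- The projection has the section at the vector of ones, which is equivariant since this vector is
fixed by all permutations. The section only has to be a homotopy inverse, not a morphism; the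
reversed segment to the ones is the homotopy. -/
lemma equivalent_directProduct_scaling (Q : Compositions Y) :
    Equivalent (directProduct Q scaling) Q := by
  refine ⟨fun _ z => z.1, ⟨fun _ => continuous_fst, fun _ _ _ => rfl, fun _ _ _ _ => rfl⟩,
    fun n => ⟨continuous_fst, fun _ _ => rfl, fun y => (y, unitRadii (n + 1)),
      continuous_id.prodMk continuous_const, fun _ _ => rfl, ?_, ?_⟩⟩
  · refine ⟨fun z => (z.2.1, towardsUnit (unitInterval.symm z.1) z.2.2), ?_, fun x => ?_,
      fun x => ?_, fun _ _ _ => rfl⟩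
    · exact (continuous_fst.comp continuous_snd).prodMk (continuous_towardsUnit.comp
        ((unitInterval.continuous_symm.comp continuous_fst).prodMk
          (continuous_snd.comp continuous_snd)))
    · simp only [unitInterval.symm_zero]
      exact Prod.ext rfl (towardsUnit_one x.2)
    · simp only [unitInterval.symm_one]
      exact Prod.ext rfl (towardsUnit_zero x.2)
  · exact ⟨fun z => z.2, continuous_snd, fun _ => rfl, fun _ => rfl, fun _ _ _ => rfl⟩

end Scaling

/-! ### The operads of cacti -/

/-- The representative of the new local zero in `[0, 1)` may differ from the real angle required by
`glue_assoc_seq` by an integer, which that lemma permits. -/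
lemma glue_assoc_seq_lift {k l m p q r : ℕ} (h₁ : k + l = p) (h₂ : p + m = r) (h₃ : l + m = q)
    (h₄ : k + q = r) (i : Fin (k + 1)) (b : Fin (l + 1)) (c : SpinelessCactus (k + 1))
    (ζ : Fin (k + 1) → UnitAddCircle) (d : SpinelessCactus (l + 1))
    (ξ : Fin (l + 1) → UnitAddCircle) (e : SpinelessCactus (m + 1)) :
    glue h₂ (insertEquiv h₁ i (Sum.inr b)) (glue h₁ i c (lift (ζ i)) d)
        (lift (glueSpines h₁ i ζ d ξ (insertEquiv h₁ i (Sum.inr b)))) e =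
      glue h₄ i c (lift (ζ i)) (glue h₃ b d (lift (ξ b)) e) := by
  obtain ⟨N, hN⟩ := exists_int_lift (ζ i) (ξ b) (d := d) b
  refine glue_assoc_seq h₁ h₂ h₃ h₄ i b c d e _ _ _ N ?_
  rw [glueSpines_inr, hN]

lemma glue_assoc_par_lift {k l m p q r : ℕ} (h₁ : k + l = p) (h₂ : p + m = r) (h₃ : k + m = q)
    (h₄ : q + l = r) (i a : Fin (k + 1)) (hai : a ≠ i) (c : SpinelessCactus (k + 1))
    (ζ : Fin (k + 1) → UnitAddCircle) (d : SpinelessCactus (l + 1))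
    (ξ : Fin (l + 1) → UnitAddCircle) (e : SpinelessCactus (m + 1))
    (η : Fin (m + 1) → UnitAddCircle) :
    glue h₂ (insertEquiv h₁ i (Sum.inl ⟨a, hai⟩)) (glue h₁ i c (lift (ζ i)) d)
        (lift (glueSpines h₁ i ζ d ξ (insertEquiv h₁ i (Sum.inl ⟨a, hai⟩)))) e =
      glue h₄ (insertEquiv h₃ a (Sum.inl ⟨i, hai.symm⟩)) (glue h₃ a c (lift (ζ a)) e)
        (lift (glueSpines h₃ a ζ e η (insertEquiv h₃ a (Sum.inl ⟨i, hai.symm⟩)))) d := by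
  rw [glueSpines_inl, glueSpines_inl]
  exact glue_assoc_par h₁ h₂ h₃ h₄ i a hai c d e _ _

lemma glue_relabel_lift {m n k : ℕ} (h : m + n = k) (i : Fin (m + 1))
    (c : SpinelessCactus (m + 1)) (ζ : Fin (m + 1) → UnitAddCircle) (d : SpinelessCactus (n + 1))
    (σ : Equiv.Perm (Fin (m + 1))) (τ : Equiv.Perm (Fin (n + 1))) :
    glue h (σ i) (c.relabel σ) (lift (permute σ ζ (σ i))) (d.relabel τ) =
      (glue h i c (lift (ζ i)) d).relabel (blockPerm h i σ τ) := by
  rw [permute_apply_self, glue_relabel]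

lemma isOperad_cact : IsOperad cact where
  continuous_act _ σ := continuous_relabel σ
  continuous_comp h i := continuous_glue h i continuous_fst continuous_const continuous_snd
  equivariant h i σ τ c d := glue_relabel h i c 0 d σ τ
  assoc_seq h₁ h₂ h₃ h₄ i b c d e :=
    -- Without spines all angles vanish and no correction arises, as arcs are counted from the
    -- global zero.
    glue_assoc_seq h₁ h₂ h₃ h₄ i b c d e 0 0 0 0 (by
      rw [mul_zero, neg_zero, SpinelessCactus.arc_zero d b]; simp)
  assoc_par h₁ h₂ h₃ h₄ i a hai c d e := glue_assoc_par h₁ h₂ h₃ h₄ i a hai c d e 0 0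

lemma isOperad_cacti : IsOperad cacti where
  continuous_act _ σ := (continuous_relabel σ).prodMap (permute_continuous σ)
  continuous_comp {m n k} h i := by
    have hζ : Continuous fun z : (spinedSpaces cactSpaces).space m ×
        (spinedSpaces cactSpaces).space n => z.1.2 := continuous_snd.comp continuous_fst
    exact Continuous.prodMk (continuous_glue_lift h i (continuous_fst.comp continuous_fst)
      ((continuous_apply i).comp hζ) (continuous_fst.comp continuous_snd))
      (continuous_glueSpines h i hζ (continuous_fst.comp continuous_snd)
      (continuous_snd.comp continuous_snd))
  equivariant h i σ τ c d := Prod.ext (glue_relabel_lift h i c.1 c.2 d.1 σ τ)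
    (glueSpines_permute h i σ τ c.2 d.1 d.2)
  assoc_seq h₁ h₂ h₃ h₄ i b c d e :=
    Prod.ext (glue_assoc_seq_lift h₁ h₂ h₃ h₄ i b c.1 c.2 d.1 d.2 e.1)
      (glueSpines_assoc_seq h₁ h₂ h₃ h₄ i b c.2 d.1 d.2 e.1 e.2)
  assoc_par h₁ h₂ h₃ h₄ i a hai c d e :=
    Prod.ext (glue_assoc_par_lift h₁ h₂ h₃ h₄ i a hai c.1 c.2 d.1 d.2 e.1 e.2)
      (glueSpines_assoc_par h₁ h₂ h₃ h₄ i a hai c.2 d.1 d.2 e.1 e.2)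

/-! ### Normalized cacti and perturbed compositions -/

section Perturbed

variable {m n k : ℕ}

lemma scaleLobe_relabel (c : SpinelessCactus n) (σ : Equiv.Perm (Fin n)) (i : Fin n) (t : PosReal) :
    (c.relabel σ).scaleLobe (σ i) t = (c.scaleLobe i t).relabel σ := by
  rw [scaleLobe, scaleLobe, ← withRadii_relabel, radii_relabel]
  congr 1
  funext j
  obtain ⟨j, rfl⟩ := σ.surjective j
  rw [permute_apply_self]
  by_cases hj : j = i
  · subst hj; simp
  · rw [Function.update_of_ne (σ.injective.ne hj), Function.update_of_ne hj, permute_apply_self]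

lemma normalize_relabel (c : SpinelessCactus (n + 1)) (σ : Equiv.Perm (Fin (n + 1))) :
    normalize (c.relabel σ) = cactNormSpaces.act n σ (normalize c) :=
  Subtype.ext (show (c.relabel σ).withRadii (unitRadii (n + 1)) = (c.withRadii (unitRadii (n + 1))).relabel σ
    from withRadii_relabel c (unitRadii (n + 1)) σ)

lemma continuous_cactNorm_act (n : ℕ) (σ : Equiv.Perm (Fin (n + 1))) :
    Continuous (cactNormSpaces.act n σ) := by
  refine continuous_norm (f := fun c => cactNormSpaces.act n σ c) fun j x => ?_
  exact (continuous_arc j x).comp ((continuous_relabel σ).comp continuous_norm_val)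

/-- Scaling the lobes of the first cactus does not change the normalization of the glued cactus. -/
lemma normalize_glue_withRadii (h : m + n = k) (i : Fin (m + 1)) (c : SpinelessCactus (m + 1))
    (t : Fin (m + 1) → PosReal) (θ : ℝ) (d : SpinelessCactus (n + 1)) :
    normalize (glue h i (c.withRadii t) θ d) = normalize (glue h i c θ d) := by
  rw [withRadii_glue, normalize_withRadii]

lemma normalize_glue (h : m + n = k) (i : Fin (m + 1)) (c : SpinelessCactus (m + 1))
    (t : PosReal) (θ : ℝ) (d : SpinelessCactus (n + 1)) :
    normalize (glue h i ((normalize c).1.scaleLobe i t) θ d) = normalize (glue h i c θ d) := by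
  rw [scaleLobe, normalize_glue_withRadii]
  exact normalize_glue_withRadii h i c (unitRadii (m + 1)) θ d

/-- The perimeter of `d` is the sum of its radii, so reparameterizing its outside circle to the
length of lobe `i` is the normalization in the scaling operad. -/
lemma radii_glue (h : m + n = k) (i : Fin (m + 1)) (c : SpinelessCactus (m + 1)) (θ : ℝ)
    (d : SpinelessCactus (n + 1)) : (glue h i c θ d).radii = scale h i c.radii d.radii := by
  refine funext_insert h i (fun a => ?_) (fun b => ?_)
  · rw [scale_inl]; exact Subtype.ext (radius_glue_inl h i c θ d a)
  · ext
    rw [scale_inr, coe_total]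
    simp only [coe_radii]
    rw [sum_radius, radius_glue_inr]

lemma withRadii_unitRadii (c : NormSpinelessCactus n) : c.1.withRadii (unitRadii n) = c.1 :=
  withRadii_eq_self c.2

/-- At the vector of ones the lobes of `d` keep their size and the glued cactus is already
normalized. -/
lemma cactNormPerturbed_unitRadii (h : m + n = k) (i : Fin (m + 1))
    (c : cactNormSpaces.space m) (d : cactNormSpaces.space n) :
    cactNormPerturbed.comp h i c (unitRadii (n + 1)) d = cactNorm.comp h i c d :=
  (congrArg (fun d' => normalize
    (glue h i (c.1.scaleLobe i (total (unitRadii (n + 1)))) 0 d')) (withRadii_unitRadii d)).trans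
    (normalize_coe (cactNorm.comp h i c d))

lemma cactiNormPerturbed_unitRadii (h : m + n = k) (i : Fin (m + 1))
    (c : (spinedSpaces cactNormSpaces).space m) (d : (spinedSpaces cactNormSpaces).space n) :
    cactiNormPerturbed.comp h i c (unitRadii (n + 1)) d = cactiNorm.comp h i c d :=
  (congrArg (fun d' => (normalize (glue h i (c.1.1.scaleLobe i (total (unitRadii (n + 1))))
    (lift (c.2 i)) d'), glueSpines h i c.2 d' d.2)) (withRadii_unitRadii d.1)).trans
    (Prod.ext (normalize_coe (cactiNorm.comp h i c d).1) rfl)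

lemma normalize_glue_relabel (h : m + n = k) (i : Fin (m + 1)) (σ : Equiv.Perm (Fin (m + 1)))
    (τ : Equiv.Perm (Fin (n + 1))) (c : SpinelessCactus (m + 1)) (θ : ℝ)
    (r : Fin (n + 1) → PosReal) (d : SpinelessCactus (n + 1)) :
    normalize (glue h (σ i) ((c.relabel σ).scaleLobe (σ i) (total (permute τ r))) θ
      ((d.relabel τ).withRadii (permute τ r))) =
    cactNormSpaces.act k (blockPerm h i σ τ)
      (normalize (glue h i (c.scaleLobe i (total r)) θ (d.withRadii r))) := by
  rw [total_permute, scaleLobe_relabel, withRadii_relabel, glue_relabel, normalize_relabel]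

lemma isPerturbed_cactNormPerturbed : IsPerturbed cactNormPerturbed where
  continuous_comp h i :=
    continuous_normalize.comp (continuous_glue h i
      (continuous_scaleLobe (continuous_norm_val.comp continuous_fst) i
        (continuous_total.comp (continuous_fst.comp continuous_snd)))
      continuous_const
      (continuous_withRadii (continuous_norm_val.comp (continuous_snd.comp continuous_snd))
        (continuous_fst.comp continuous_snd)))
  equivariant h i σ τ c r d := normalize_glue_relabel h i σ τ c.1 0 r d.1

lemma isPerturbed_cactiNormPerturbed : IsPerturbed cactiNormPerturbed where
  continuous_comp {m n k} h i := by
    have hd : Continuous fun z : (spinedSpaces cactNormSpaces).space m × scalingSpaces.space n ×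
        (spinedSpaces cactNormSpaces).space n => z.2.2.1.1.withRadii z.2.1 :=
      continuous_withRadii
        (continuous_norm_val.comp (continuous_fst.comp (continuous_snd.comp continuous_snd)))
        (continuous_fst.comp continuous_snd)
    have hζ : Continuous fun z : (spinedSpaces cactNormSpaces).space m × scalingSpaces.space n ×
        (spinedSpaces cactNormSpaces).space n => z.1.2 :=
      continuous_snd.comp continuous_fst
    refine Continuous.prodMk (continuous_normalize.comp (continuous_glue_lift h i
      (continuous_scaleLobe (continuous_norm_val.comp (continuous_fst.comp continuous_fst)) i
        (continuous_total.comp (continuous_fst.comp continuous_snd)))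
      ((continuous_apply i).comp hζ) hd)) (continuous_glueSpines h i hζ hd
      (continuous_snd.comp (continuous_snd.comp continuous_snd)))
  equivariant {m n k} h i σ τ c r d := by
    have hζ : lift (permute σ c.2 (σ i)) = lift (c.2 i) := congrArg lift (permute_apply_self σ c.2 i)
    refine Prod.ext ?_ ?_
    · exact (congrArg (fun θ => normalize (glue h (σ i)
        ((c.1.1.relabel σ).scaleLobe (σ i) (total (permute τ r))) θ
        ((d.1.1.relabel τ).withRadii (permute τ r)))) hζ).trans
        (normalize_glue_relabel h i σ τ c.1.1 _ r d.1.1)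
    · exact (congrArg (fun d' => glueSpines h (σ i) (permute σ c.2) d' (permute τ d.2))
        (withRadii_relabel d.1.1 r τ)).trans
        (glueSpines_permute h i σ τ c.2 (d.1.1.withRadii r) d.2)

lemma continuous_cactiNorm_act (n : ℕ) (σ : Equiv.Perm (Fin (n + 1))) :
    Continuous ((spinedSpaces cactNormSpaces).act n σ) :=
  (continuous_cactNorm_act n σ).prodMap (permute_continuous σ)

/-! ### Isomorphism with the semi-direct product -/

lemma withRadii_radii_normalize (c : SpinelessCactus n) :
    (normalize c).1.withRadii c.radii = c := by
  rw [withRadii_normalize, withRadii_radii]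

/-- The normalized composition needs only the shape of `c`, but both the shape and the radii of `d`:
this is compatibility with the second component of the semi-direct product. -/
lemma normalize_glue_normalize (h : m + n = k) (i : Fin (m + 1)) (c : SpinelessCactus (m + 1))
    (θ : ℝ) (d : SpinelessCactus (n + 1)) :
    normalize (glue h i c θ d) = normalize (glue h i
      ((normalize c).1.scaleLobe i (total d.radii)) θ ((normalize d).1.withRadii d.radii)) := by
  rw [withRadii_radii_normalize, normalize_glue]

lemma isMorphism_cact : IsMorphism cact (rightSemidirectProduct scaling cactNormPerturbed)
    (fun _ c => (radii c, normalize c)) where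
  continuous _ := continuous_radii.prodMk continuous_normalize
  map_act _ σ c := Prod.ext (radii_relabel c σ) (normalize_relabel c σ)
  map_comp h i c d := Prod.ext (radii_glue h i c 0 d) (normalize_glue_normalize h i c 0 d)

lemma isMorphism_cacti : IsMorphism cacti (rightSemidirectProduct scaling cactiNormPerturbed)
    (fun _ c => (radii c.1, (normalize c.1, c.2))) where
  continuous _ := (continuous_radii.comp continuous_fst).prodMk
    ((continuous_normalize.comp continuous_fst).prodMk continuous_snd)
  map_act _ σ c := Prod.ext (radii_relabel c.1 σ) (Prod.ext (normalize_relabel c.1 σ) rfl)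
  map_comp h i c d := Prod.ext (radii_glue h i c.1 _ d.1)
    (Prod.ext (normalize_glue_normalize h i c.1 _ d.1)
      (congrArg (fun d' => glueSpines h i c.2 d' d.2) (withRadii_radii_normalize d.1).symm))

end Perturbed

lemma continuous_norm_withRadii (n : ℕ) :
    Continuous fun z : (Fin n → PosReal) × NormSpinelessCactus n => z.2.1.withRadii z.1 :=
  continuous_withRadii (continuous_norm_val.comp continuous_snd) continuous_fst

/-- The inverse of `c ↦ (radii c, normalize c)` rescales a normalized cactus to the prescribed
radii. -/
lemma isomorphic_cact :
    IsOperad (rightSemidirectProduct scaling cactNormPerturbed) ∧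
      Isomorphic cact (rightSemidirectProduct scaling cactNormPerturbed) := by
  have hgf : ∀ (n : ℕ) (c : SpinelessCactus (n + 1)), (normalize c).1.withRadii c.radii = c :=
    fun _ c => withRadii_radii_normalize c
  have hfg : ∀ (n : ℕ) (z : (Fin (n + 1) → PosReal) × NormSpinelessCactus (n + 1)),
      ((z.2.1.withRadii z.1).radii, normalize (z.2.1.withRadii z.1)) = z := fun _ z =>
    Prod.ext (radii_withRadii _ _) ((normalize_withRadii _ _).trans (normalize_coe _))
  obtain ⟨h1, h2⟩ := isOperad_cact.of_iso isMorphism_cact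
    (g := fun n (z : (Fin (n + 1) → PosReal) × NormSpinelessCactus (n + 1)) =>
      z.2.1.withRadii z.1) (fun n => continuous_norm_withRadii (n + 1)) hgf hfg
  exact ⟨h2, _, _, isMorphism_cact, h1, hgf, hfg⟩

lemma isomorphic_cacti :
    IsOperad (rightSemidirectProduct scaling cactiNormPerturbed) ∧
      Isomorphic cacti (rightSemidirectProduct scaling cactiNormPerturbed) := by
  have hgf : ∀ (n : ℕ) (c : SpinelessCactus (n + 1) × (Fin (n + 1) → UnitAddCircle)),
      ((normalize c.1).1.withRadii c.1.radii, c.2) = c :=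
    fun _ c => Prod.ext (withRadii_radii_normalize c.1) rfl
  have hfg : ∀ (n : ℕ) (z : (Fin (n + 1) → PosReal) ×
      (NormSpinelessCactus (n + 1) × (Fin (n + 1) → UnitAddCircle))),
      ((z.2.1.1.withRadii z.1).radii, (normalize (z.2.1.1.withRadii z.1), z.2.2)) = z := fun _ z =>
    Prod.ext (radii_withRadii _ _)
      (Prod.ext ((normalize_withRadii _ _).trans (normalize_coe _)) rfl)
  obtain ⟨h1, h2⟩ := isOperad_cacti.of_iso isMorphism_cacti
    (g := fun n (z : (Fin (n + 1) → PosReal) ×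
      (NormSpinelessCactus (n + 1) × (Fin (n + 1) → UnitAddCircle))) =>
      (z.2.1.1.withRadii z.1, z.2.2))
    (fun n => ((continuous_norm_withRadii (n + 1)).comp
      (continuous_fst.prodMk (continuous_fst.comp continuous_snd))).prodMk
        (continuous_snd.comp continuous_snd)) hgf hfg
  exact ⟨h2, _, _, isMorphism_cacti, h1, hgf, hfg⟩

end

end CactiOperads

theorem theorem5p1p2 :
    -- spineless cacti
    (IsOperad scaling ∧ IsOperad cact ∧ IsQuasiOperad cactNorm ∧ IsPerturbed cactNormPerturbed ∧
      IsOperad (rightSemidirectProduct scaling cactNormPerturbed) ∧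
      Isomorphic cact (rightSemidirectProduct scaling cactNormPerturbed) ∧
      HomotopyEquivalent (rightSemidirectProduct scaling cactNormPerturbed)
        (directProduct scaling cactNorm) ∧
      Isomorphic (directProduct scaling cactNorm) (directProduct cactNorm scaling) ∧
      Equivalent (directProduct cactNorm scaling) cactNorm) ∧
    -- cacti with spines
    (IsOperad cacti ∧ IsQuasiOperad cactiNorm ∧ IsPerturbed cactiNormPerturbed ∧
      IsOperad (rightSemidirectProduct scaling cactiNormPerturbed) ∧
      Isomorphic cacti (rightSemidirectProduct scaling cactiNormPerturbed) ∧
      HomotopyEquivalent (rightSemidirectProduct scaling cactiNormPerturbed)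
        (directProduct scaling cactiNorm) ∧
      Isomorphic (directProduct scaling cactiNorm) (directProduct cactiNorm scaling) ∧
      Equivalent (directProduct cactiNorm scaling) cactiNorm) := by
  exact ⟨⟨isOperad_scaling, isOperad_cact,
      isPerturbed_cactNormPerturbed.isQuasiOperad continuous_cactNorm_act
        cactNormPerturbed_unitRadii,
      isPerturbed_cactNormPerturbed, isomorphic_cact.1, isomorphic_cact.2,
      isPerturbed_cactNormPerturbed.homotopyEquivalent continuous_cactNorm_act
        cactNormPerturbed_unitRadii,
      isomorphic_directProduct_comm _ _, equivalent_directProduct_scaling _⟩,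
    ⟨isOperad_cacti,
      isPerturbed_cactiNormPerturbed.isQuasiOperad continuous_cactiNorm_act
        cactiNormPerturbed_unitRadii,
      isPerturbed_cactiNormPerturbed, isomorphic_cacti.1, isomorphic_cacti.2,
      isPerturbed_cactiNormPerturbed.homotopyEquivalent continuous_cactiNorm_act
        cactiNormPerturbed_unitRadii,
      isomorphic_directProduct_comm _ _, equivalent_directProduct_scaling _⟩⟩
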